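/- **Setting.** For $\eta\ge 0$ let $\mathcal P_1(\eta)$ be the class of probability distributions $\mathcal D$ on $\mathbb R^d$, with some mean $m$, that have covariance $\eta^2 I$ and are $1$-sub-Gaussian, i.e. $\mathbb E_{X\sim\mathcal D}[\exp((X-m)^\top v)]\le \exp(\|v\|_2^2/2)$ for all $v\in\mathbb R^d$. An *$\varepsilon$-corrupted dataset* $X^{(1)},\dots,X^{(N)}\in(\mathbb R\cup\{*\})^d$ is generated from $\mathcal P_1(\eta)$ by a (possibly randomized) adversary as follows. (1) The adversary chooses sets $P^{(i)}\subseteq\{1,\dots,d\}$ of present coordinates, $i=1,\dots,N$. (2) The adversary chooses distributions $\mathcal D^{(i)}\in\mathcal P_1(\eta)$, $i=1,\dots,N$, all with the same mean $\mu$, and then the $X^{(i)}\sim\mathcal D^{(i)}$ are drawn independently. (3) The adversary, seeing everything, modifies at most $\varepsilon N$ of the examples arbitrarily, possibly including their sets $P^{(i)}$. (4) $X^{(i)}_j$ is replaced by $*$ whenever $j\notin P^{(i)}$. Let $\Gamma_j$ be the set of $i$ with $X^{(i)}_j\ne *$ in the resulting dataset. The dataset is *$\gamma$-complete* if $|\Gamma_j|\ge\gamma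 N$ for all $j$. The *completed dataset* $X^{(i,0)}\in\mathbb R^d$ is obtained by replacing the missing entries by independent $\mathcal N(0,\eta^2)$ variables, independent of the process that generated the dataset. The *adjusted dataset* is $X^{(i,\mu)}_j=X^{(i,0)}_j$ if $i\in\Gamma_j$ and $X^{(i,\mu)}_j=X^{(i,0)}_j+\mu_j$ otherwise. The completed dataset is *$(\varepsilon,g_*,\eta,\beta)$-good* with respect to $\mu$ if there is $G\subseteq\{1,\dots,N\}$ with $|G|\ge(1-\varepsilon)N$ such that, with $G_j=G\cap\Gamma_j$, one has $|G_j|/|G|\ge g_*$ for all $j$, and for all weights $w^{(1)},\dots,w^{(N)}\ge0$ with $\sum_i w^{(i)}=1$, $w^{(i)}=0$ for $i\notin G$ and $w^{(i)}\le\frac1{(1-3\varepsilon)N}$ for all $i$, $$\Big\|\sum_{i\in G}w^{(i)}(X^{(i,\mu)}-\mu)\Big\|_2\le\beta\sqrt\varepsilon,\qquad \Big\|\sum_{i\in G}w^{(i)}(X^{(i,\mu)}-\mu)(X^{(i,\mu)}-\mu)^\top-\eta^2I\Big\|_{\rm op}\le\beta^2,$$ $$\Big\|\sum_{i\in G_j}w^{(i)}(X^{(i,\mu)}-\mu)\Big\|_2\le\beta\sqrt\varepsilon\quad\text{for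 all } j=1,\dots,d.$$ **Lemma.** There is an absolute constant $C>0$ such that the following holds for all $N\ge1$, all $d$, all $\eta\ge0$, all $\varepsilon>0$, $\gamma$ with $10\varepsilon\le\gamma\le1$, and all $\delta\in(0,1/2)$. For every $\varepsilon$-corrupted dataset generated from $\mathcal P_1(\eta)$, the event that the dataset is $\gamma$-complete but its completed dataset is not $(\varepsilon,0.9\gamma,\eta,\beta)$-good with respect to $\mu$ has probability at most $\delta$, where $$\beta=C\sqrt{\frac{d+\log(1/\delta)}{N\varepsilon}+\varepsilon\log(1/\varepsilon)}.$$ -/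

import Mathlib

open MeasureTheory ProbabilityTheory
open scoped BigOperators RealInnerProductSpace

noncomputable section

namespace RobustMean

/-! ### Classes of distributions -/

/-- A distribution `D` on `ℝ^d` with mean `m = 𝔼 x` is `σ²`-sub-Gaussian if
`𝔼 exp ⟪x - m, v⟫ ≤ exp (σ² ‖v‖² / 2)` for every vector `v`
(in particular the mean and these expectations exist). -/
def IsSubGaussian {d : ℕ} (σ : ℝ) (D : Measure (EuclideanSpace ℝ (Fin d))) : Prop :=
  Integrable (fun x => x) D ∧
  ∀ v : EuclideanSpace ℝ (Fin d),
    Integrable (fun x => Real.exp ⟪x - ∫ y, y ∂D, v⟫) D ∧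
    ∫ x, Real.exp ⟪x - ∫ y, y ∂D, v⟫ ∂D ≤ Real.exp (σ ^ 2 * ‖v‖ ^ 2 / 2)

/-- The covariance matrix of a distribution on `ℝ^d`. -/
def covMatrix {d : ℕ} (D : Measure (EuclideanSpace ℝ (Fin d))) : Matrix (Fin d) (Fin d) ℝ :=
  Matrix.of fun j k => covariance (fun x => x j) (fun x => x k) D

/-- The class of `1`-sub-Gaussian probability distributions on `ℝ^d` with covariance `η² I`. -/
def classP1 (d : ℕ) (η : ℝ) : Set (Measure (EuclideanSpace ℝ (Fin d))) :=
  {D | IsProbabilityMeasure D ∧ IsSubGaussian 1 D ∧ covMatrix D = η ^ 2 • 1}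

/-! ### Incomplete, completed and adjusted datasets -/

/-- An incomplete dataset of `N` examples in `(ℝ ∪ {*})^d`; `none` is the placeholder `*`. -/
abbrev IncompleteDataset (N d : ℕ) : Type := Fin N → Fin d → Option ℝ

/-- `Γ_j`, the set of examples in which coordinate `j` is present. -/
def presentIn {N d : ℕ} (Y : IncompleteDataset N d) (j : Fin d) : Finset (Fin N) :=
  Finset.univ.filter fun i => (Y i j).isSome

/-- `γ`-completeness: every coordinate is present in at least `γ N` examples. -/
def IsGammaComplete {N d : ℕ} (γ : ℝ) (Y : IncompleteDataset N d) : Prop :=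
  ∀ j, γ * N ≤ ((presentIn Y j).card : ℝ)

/-- The completed dataset: the missing entries of `Y` are replaced by the entries of `ξ`. -/
def fillMissing {N d : ℕ} (Y : IncompleteDataset N d) (ξ : Fin N → Fin d → ℝ) :
    Fin N → EuclideanSpace ℝ (Fin d) :=
  fun i => WithLp.toLp 2 fun j => (Y i j).getD (ξ i j)

/-- The dataset adjusted by a guess `ν`: from the completed dataset `Z` of `Y`, add `ν_j` to
every entry that was missing in `Y`. -/
def adjust {N d : ℕ} (Y : IncompleteDataset N d) (Z : Fin N → EuclideanSpace ℝ (Fin d))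
    (ν : EuclideanSpace ℝ (Fin d)) : Fin N → EuclideanSpace ℝ (Fin d) :=
  fun i => WithLp.toLp 2 fun j => if (Y i j).isSome then Z i j else Z i j + ν j

/-! ### Goodness -/

/-- `Δ_{G,p}`: probability weights on `{1, …, N}` supported on `G`, each at most `1 / p`. -/
def weights {N : ℕ} (G : Finset (Fin N)) (p : ℝ) : Set (Fin N → ℝ) :=
  {w | (∀ i, 0 ≤ w i) ∧ ∑ i, w i = 1 ∧ (∀ i, i ∉ G → w i = 0) ∧ ∀ i, w i ≤ 1 / p}

/-- The operator (spectral) norm of a real square matrix. -/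
def opNorm {d : ℕ} (M : Matrix (Fin d) (Fin d) ℝ) : ℝ :=
  ‖Matrix.toEuclideanCLM (n := Fin d) (𝕜 := ℝ) M‖

/-- The rank-one matrix `x xᵀ`. -/
def outer {d : ℕ} (x : EuclideanSpace ℝ (Fin d)) : Matrix (Fin d) (Fin d) ℝ :=
  Matrix.of fun j k => x j * x k

/-- The completed dataset `Z` of the incomplete dataset `Y` is `(ε, g, η, β)`-good
with respect to `μ`. -/
def IsGood {N d : ℕ} (ε g η β : ℝ) (μ : EuclideanSpace ℝ (Fin d))
    (Y : IncompleteDataset N d) (Z : Fin N → EuclideanSpace ℝ (Fin d)) : Prop :=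
  ∃ G : Finset (Fin N),
    (1 - ε) * N ≤ (G.card : ℝ) ∧
    (∀ j, g ≤ ((G ∩ presentIn Y j).card : ℝ) / G.card) ∧
    ∀ w ∈ weights G ((1 - 3 * ε) * N),
      ‖∑ i ∈ G, w i • (adjust Y Z μ i - μ)‖ ≤ β * √ε ∧
      opNorm ((∑ i ∈ G, w i • outer (adjust Y Z μ i - μ)) - η ^ 2 • 1) ≤ β ^ 2 ∧
      ∀ j, ‖∑ i ∈ G ∩ presentIn Y j, w i • (adjust Y Z μ i - μ)‖ ≤ β * √ε

/-! ### The corruption model -/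

/-- An `ε`-corrupted dataset of `N` examples in `ℝ^d`, generated from the class `𝓓` by a
randomized adversary, on the probability space `(Ω, Pr)`. -/
structure CorruptedDataset (N d : ℕ) (ε : ℝ) (𝓓 : Set (Measure (EuclideanSpace ℝ (Fin d))))
    {Ω : Type*} [MeasurableSpace Ω] (Pr : Measure Ω) (S : Type*) [MeasurableSpace S] where
  /-- The randomness of the adversary used in the first two steps. -/
  seed : Ω → S
  measurable_seed : Measurable seed
  /-- Step 1: the sets of present coordinates, chosen before the examples are drawn. -/
  present : S → Fin N → Set (Fin d)
  measurable_present : Measurable present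
  /-- Step 2: the common mean of the chosen distributions. -/
  mean : S → EuclideanSpace ℝ (Fin d)
  /-- Step 2: the chosen distributions. -/
  dist : S → Fin N → Measure (EuclideanSpace ℝ (Fin d))
  dist_mem : ∀ s i, dist s i ∈ 𝓓
  dist_mean : ∀ s i, ∫ x, x ∂(dist s i) = mean s
  /-- Step 2: the examples before corruption. -/
  clean : Ω → Fin N → EuclideanSpace ℝ (Fin d)
  measurable_clean : Measurable clean
  /-- The joint law of the examples before corruption, given the choices of the adversary. -/
  law : Kernel S (Fin N → EuclideanSpace ℝ (Fin d))
  /-- The examples are drawn independently from the chosen distributions ... -/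
  law_eq : ∀ s, law s = Measure.pi (dist s)
  /-- ... that is, conditionally on the choices of the adversary, `clean` has this law. -/
  map_seed_clean : Pr.map (fun ω => (seed ω, clean ω)) = (Pr.map seed) ⊗ₘ law
  /-- Step 3: the examples after corruption; they may depend on everything drawn so far and on
  additional randomness. -/
  value : Ω → Fin N → EuclideanSpace ℝ (Fin d)
  measurable_value : Measurable value
  /-- Step 3: the sets of present coordinates after corruption. -/
  mask : Ω → Fin N → Set (Fin d)
  measurable_mask : Measurable mask
  /-- Step 3: at most `ε N` examples are modified. -/
  card_corrupted_le : ∀ ω,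
    (Set.ncard {i | value ω i ≠ clean ω i ∨ mask ω i ≠ present (seed ω) i} : ℝ) ≤ ε * N

open Classical in
/-- Step 4: the observed dataset, where the coordinates that are not present are concealed. -/
def CorruptedDataset.observed {N d : ℕ} {ε : ℝ}
    {𝓓 : Set (Measure (EuclideanSpace ℝ (Fin d)))} {Ω : Type*} [MeasurableSpace Ω]
    {Pr : Measure Ω} {S : Type*} [MeasurableSpace S] (A : CorruptedDataset N d ε 𝓓 Pr S) (ω : Ω) :
    IncompleteDataset N d :=
  fun i j => if j ∈ A.mask ω i then some (A.value ω i j) else none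

/-- `ξ` consists of independent `N(0, η²)` variables which are independent of the whole process
that generates the dataset. -/
structure IsGaussianFill {N d : ℕ} {ε : ℝ} {𝓓 : Set (Measure (EuclideanSpace ℝ (Fin d)))}
    {Ω : Type*} [MeasurableSpace Ω] {Pr : Measure Ω} {S : Type*} [MeasurableSpace S]
    (A : CorruptedDataset N d ε 𝓓 Pr S) (η : ℝ) (ξ : Ω → Fin N → Fin d → ℝ) : Prop where
  measurable : Measurable ξ
  map_eq : Pr.map ξ =
    Measure.pi fun _ : Fin N => Measure.pi fun _ : Fin d => gaussianReal 0 (η ^ 2).toNNReal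
  indep : IndepFun ξ (fun ω => (A.seed ω, A.clean ω, A.value ω, A.mask ω)) Pr

end RobustMean

end

open RobustMean

noncomputable section
namespace RobustMean

/-! ### Exponential moments of squares of sub-Gaussian variables -/

/-! On an untouched example, the adjusted point minus `μ` is the centred clean example with its
concealed coordinates replaced by Gaussian noise (`adjust_sub_mean_eq`). The presence sets and
distributions are fixed by the seed before sampling. So, conditionally on the seed, these vectors
are independent, centred and 1-sub-Gaussian with covariance `η² I`
(`isCenteredSubGaussian_map_centerFill`).

Take `G` to be the untouched examples. It depends on the data, but admissible weights vanish off
`G`, so every sum in the definition of goodness equals a sum over indices fixed before the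
corruption. No union bound over `G` is needed, and adaptive corruption plays no further role.

Uniformity over weights is deterministic. Admissible weights are within `10ε` of uniform in `ℓ¹`,
and entrywise within `1/N` (`abs_sub_uniform_le`). The uniform part is an ordinary empirical
average. The deviation is controlled by truncating the squares at `4 log (1/ε)` and using
Cauchy–Schwarz for linear sums (`IsRegular.sum_abs_mul_sq_le`, `IsRegular.abs_quadratic_le`,
`IsRegular.linear_le`).

It remains to bound finitely many averages: `d + 1` linear sums, the second moment from both sides,
and the truncated tail, each in at most `3 · 25 ^ d` directions (`exists_test_set`). Each follows
from a Chernoff bound with failure probability `exp (-L)`, and `L = 10 (d + log (1/δ))` pays for the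
union bound (`measure_not_isRegular_le_ofReal`). Integrating over the seed concludes. -/

theorem ofReal_exp_mul_gaussianPDF (x : ℝ) :
    ENNReal.ofReal (Real.exp (x ^ 2 / 4)) * gaussianPDF 0 1 x =
      ENNReal.ofReal (√2) * gaussianPDF 0 2 x := by
  unfold gaussianPDF
  rw [← ENNReal.ofReal_mul (by positivity), ← ENNReal.ofReal_mul (by positivity)]
  congr 1
  simp only [gaussianPDFReal, NNReal.coe_one, NNReal.coe_ofNat, mul_one, sub_zero]
  have h2 : √(2 * Real.pi * 2) = √(2 * Real.pi) * √2 := Real.sqrt_mul (by positivity) _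
  have h3 : √2 * (√(2 * Real.pi) * √2)⁻¹ = (√(2 * Real.pi))⁻¹ := by
    have : √(2 * Real.pi) ≠ 0 := by positivity
    field_simp
  rw [h2, ← mul_assoc √2, h3, mul_left_comm, ← Real.exp_add]
  ring_nf

theorem lintegral_exp_sq_gaussianReal :
    ∫⁻ x, ENNReal.ofReal (Real.exp (x ^ 2 / 4)) ∂(gaussianReal 0 1) = ENNReal.ofReal (√2) := by
  rw [gaussianReal_of_var_ne_zero 0 one_ne_zero,
    lintegral_withDensity_eq_lintegral_mul _ (measurable_gaussianPDF 0 1) (by fun_prop)]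
  calc _ = ∫⁻ x, ENNReal.ofReal (√2) * gaussianPDF 0 2 x := by
        refine lintegral_congr fun x => ?_
        rw [← ofReal_exp_mul_gaussianPDF, Pi.mul_apply, mul_comm]
    _ = _ := by
        rw [lintegral_const_mul _ (measurable_gaussianPDF 0 2),
          lintegral_gaussianPDF_eq_one 0 two_ne_zero, mul_one]

theorem two_add_sq_le_exp_add_exp_neg (x : ℝ) : 2 + x ^ 2 ≤ Real.exp x + Real.exp (-x) := by
  wlog h : 0 ≤ x generalizing x
  · have := this (-x) (by linarith)
    rw [neg_neg, neg_sq] at this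
    linarith
  have h1 : x / 2 ≤ Real.sinh (x / 2) := Real.self_le_sinh_iff.2 (by linarith)
  have h2 := Real.cosh_two_mul (x / 2)
  rw [Real.cosh_sq, mul_div_cancel₀ _ two_ne_zero, Real.cosh_eq] at h2
  nlinarith

section OneDim

variable {Ω : Type*} [MeasurableSpace Ω] {μ : Measure Ω} [IsProbabilityMeasure μ] {X : Ω → ℝ}

/-- Gaussian linearisation: `exp (X²/4)` is the mean of `exp (X g / √2)` over a standard Gaussian
`g`. After exchanging the integrals, the sub-Gaussian bound in `X` leaves `exp (g²/4)`, whose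
Gaussian mean is `√2`. -/
theorem lintegral_exp_sq_le (hX : Measurable X) (h : HasSubgaussianMGF X 1 μ) :
    ∫⁻ ω, ENNReal.ofReal (Real.exp (X ω ^ 2 / 4)) ∂μ ≤ ENNReal.ofReal (√2) := by
  have h1 : ∀ ω, ENNReal.ofReal (Real.exp (X ω ^ 2 / 4)) =
      ∫⁻ g, ENNReal.ofReal (Real.exp ((X ω / √2) * g)) ∂(gaussianReal 0 1) := by
    intro ω
    rw [← ofReal_integral_eq_lintegral_ofReal (integrable_exp_mul_gaussianReal _)
      (ae_of_all _ fun _ => (Real.exp_pos _).le)]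
    have := congrFun (mgf_fun_id_gaussianReal (μ := 0) (v := 1)) (X ω / √2)
    simp only [mgf] at this
    rw [this, div_pow, Real.sq_sqrt (by norm_num)]
    simp only [NNReal.coe_one]
    ring_nf
  simp_rw [h1]
  rw [lintegral_lintegral_swap (by fun_prop), ← lintegral_exp_sq_gaussianReal]
  refine lintegral_mono fun g => ?_
  have h2 : ∀ ω, X ω / √2 * g = (g / √2) * X ω := fun ω => by ring
  simp_rw [h2]
  rw [← ofReal_integral_eq_lintegral_ofReal (h.integrable_exp_mul _)
      (ae_of_all _ fun _ => (Real.exp_pos _).le)]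
  refine ENNReal.ofReal_le_ofReal ((h.mgf_le _).trans_eq ?_)
  rw [div_pow, Real.sq_sqrt (by norm_num)]
  simp only [NNReal.coe_one]
  ring_nf

theorem integrable_exp_sq (hX : Measurable X) (h : HasSubgaussianMGF X 1 μ) :
    Integrable (fun ω => Real.exp (X ω ^ 2 / 4)) μ :=
  ⟨by fun_prop, by
    rw [hasFiniteIntegral_iff_ofReal (ae_of_all _ fun _ => (Real.exp_pos _).le)]
    exact (lintegral_exp_sq_le hX h).trans_lt ENNReal.ofReal_lt_top⟩

theorem integral_exp_sq_le (hX : Measurable X) (h : HasSubgaussianMGF X 1 μ) :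
    ∫ ω, Real.exp (X ω ^ 2 / 4) ∂μ ≤ √2 := by
  rw [← ENNReal.ofReal_le_ofReal_iff (by positivity), ofReal_integral_eq_lintegral_ofReal
    (integrable_exp_sq hX h) (ae_of_all _ fun _ => (Real.exp_pos _).le)]
  exact lintegral_exp_sq_le hX h

/-- The integrand is at most `1 + exp (-t/4) exp (X²/4)`. At `t = 4 log (1/ε)` the bound becomes
`exp (2ε)`, so the truncated squares cost only order `ε` per example. -/
theorem lintegral_exp_posPart_le (hX : Measurable X) (h : HasSubgaussianMGF X 1 μ) (t : ℝ) :
    ∫⁻ ω, ENNReal.ofReal (Real.exp (1 / 4 * max (X ω ^ 2 - t) 0)) ∂μ ≤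
      ENNReal.ofReal (Real.exp (2 * Real.exp (-t / 4))) := by
  have hpt : ∀ ω, Real.exp (1 / 4 * max (X ω ^ 2 - t) 0) ≤
      1 + Real.exp (-t / 4) * Real.exp (X ω ^ 2 / 4) := by
    intro ω
    rcases le_total (X ω ^ 2 - t) 0 with h0 | h0
    · rw [max_eq_right h0, mul_zero, Real.exp_zero]
      linarith [mul_pos (Real.exp_pos (-t / 4)) (Real.exp_pos (X ω ^ 2 / 4))]
    · rw [max_eq_left h0, ← Real.exp_add]
      ring_nf
      linarith
  have hint : Integrable (fun ω => 1 + Real.exp (-t / 4) * Real.exp (X ω ^ 2 / 4)) μ :=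
    (integrable_const _).add ((integrable_exp_sq hX h).const_mul _)
  calc _ ≤ ∫⁻ ω, ENNReal.ofReal (1 + Real.exp (-t / 4) * Real.exp (X ω ^ 2 / 4)) ∂μ :=
        lintegral_mono fun ω => ENNReal.ofReal_le_ofReal (hpt ω)
    _ = ENNReal.ofReal (∫ ω, (1 + Real.exp (-t / 4) * Real.exp (X ω ^ 2 / 4)) ∂μ) :=
        (ofReal_integral_eq_lintegral_ofReal hint (ae_of_all _ fun ω => by positivity)).symm
    _ ≤ _ := by
        refine ENNReal.ofReal_le_ofReal ?_
        rw [integral_add (integrable_const _) ((integrable_exp_sq hX h).const_mul _),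
          integral_const_mul]
        have h1 := integral_exp_sq_le hX h
        have h2 : √2 ≤ 2 := Real.sqrt_le_left (by norm_num) |>.mpr (by norm_num) 
        have h3 := Real.add_one_le_exp (2 * Real.exp (-t / 4))
        have h4 := mul_le_mul_of_nonneg_left (h1.trans h2) (Real.exp_pos (-t / 4)).le
        simp
        linarith

omit [IsProbabilityMeasure μ] in
theorem integrable_sq (h : HasSubgaussianMGF X 1 μ) : Integrable (fun ω => X ω ^ 2) μ :=
  (h.memLp 2).integrable_sq

/-- Compare the moment generating function at `t` and `-t` to second order: adding the two cancels
the linear term, and `t → 0` gives the bound. -/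
theorem integral_sq_le_one (h : HasSubgaussianMGF X 1 μ) : ∫ ω, X ω ^ 2 ∂μ ≤ 1 := by
  have key : ∀ t : ℝ, 0 < t → t ≤ 1 → ∫ ω, X ω ^ 2 ∂μ ≤ 1 + t := by
    intro t ht ht1
    have h1 : ∫ ω, (2 + t ^ 2 * X ω ^ 2) ∂μ ≤
        ∫ ω, (Real.exp (t * X ω) + Real.exp (-t * X ω)) ∂μ := by
      refine integral_mono ((integrable_const _).add ((integrable_sq h).const_mul _))
        ((h.integrable_exp_mul _).add (h.integrable_exp_mul _)) fun ω => ?_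
      have := two_add_sq_le_exp_add_exp_neg (t * X ω)
      rwa [mul_pow, ← neg_mul] at this
    rw [integral_add (integrable_const _) ((integrable_sq h).const_mul _),
      integral_add (h.integrable_exp_mul _) (h.integrable_exp_mul _), integral_const_mul] at h1
    have h2 := h.mgf_le t
    have h3 := h.mgf_le (-t)
    simp only [mgf, NNReal.coe_one] at h2 h3
    rw [neg_sq] at h3
    have h4 := Real.abs_exp_sub_one_sub_id_le (x := 1 * t ^ 2 / 2)
      (by rw [abs_of_nonneg (by positivity)]; nlinarith)
    have h5 := (abs_le.1 h4).2
    simp only [integral_const, probReal_univ, one_smul] at h1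
    have h6 : t ^ 2 * ∫ ω, X ω ^ 2 ∂μ ≤ t ^ 2 * (1 + t) := by
      have h7 : t ^ 4 ≤ t ^ 3 := pow_le_pow_of_le_one ht.le ht1 (by norm_num)
      nlinarith [pow_pos ht 3]
    exact le_of_mul_le_mul_left h6 (by positivity)
  refine le_of_forall_pos_le_add fun t ht => ?_
  exact (key (min t 1) (by positivity) (min_le_right _ _)).trans (by gcongr; exact min_le_left _ _)

theorem exp_le_one_add_add_sq_mul (x : ℝ) : Real.exp x ≤ 1 + x + x ^ 2 * Real.exp |x| := by
  rcases le_total |x| 1 with h | h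
  · have h1 := (abs_le.1 (Real.abs_exp_sub_one_sub_id_le h)).2
    have h2 := Real.one_le_exp (abs_nonneg x)
    nlinarith [sq_nonneg x]
  · rcases le_total 0 x with h0 | h0
    · rw [abs_of_nonneg h0] at *
      nlinarith [Real.exp_pos x, mul_self_nonneg (x - 1)]
    · have h2 := Real.one_le_exp (abs_nonneg x)
      have h3 : Real.exp x ≤ 1 := Real.exp_le_one_iff.2 h0
      rw [abs_of_nonpos h0] at *
      nlinarith [sq_nonneg x]

theorem exp_mul_le_of_abs_le {lam z : ℝ} (hl : |lam| ≤ 1 / 10) :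
    Real.exp (lam * z) ≤ 1 + lam * z + lam ^ 2 * (89 * Real.exp (|z| / 4)) := by
  refine (exp_le_one_add_add_sq_mul _).trans ?_
  -- From `x²/2 ≤ exp x` at `x = 3|z|/20`, since `800/9 < 89`. The exponent `1/4` is split as `3/20
  -- + 1/10`; the second part absorbs `exp |lam z|`.
  have h1 : z ^ 2 ≤ 89 * Real.exp (|z| * (3 / 20)) := by
    have := Real.quadratic_le_exp_of_nonneg (x := |z| * (3 / 20)) (by positivity)
    nlinarith [sq_abs z, abs_nonneg z]
  have h2 : |lam * z| ≤ |z| / 10 := by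
    rw [abs_mul]; nlinarith [abs_nonneg z]
  have h3 : Real.exp |lam * z| ≤ Real.exp (|z| / 10) := Real.exp_le_exp.2 h2
  have h4 : Real.exp (|z| / 4) = Real.exp (|z| * (3 / 20)) * Real.exp (|z| / 10) := by
    rw [← Real.exp_add]; ring_nf
  rw [mul_pow, h4]
  have h5 : z ^ 2 * Real.exp |lam * z| ≤
      89 * Real.exp (|z| * (3 / 20)) * Real.exp (|z| / 10) := by gcongr
  nlinarith [mul_le_mul_of_nonneg_left h5 (sq_nonneg lam)]

/-- Expand to second order: the linear term integrates to zero. As `q` lies in `[0, 1]`, the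
remainder is at most `89 lam² exp (1/4) E exp (X²/4)`, and `exp (1/4) √2 ≤ 2` gives `178`. -/
theorem lintegral_exp_centered_sq_le (hX : Measurable X) (h : HasSubgaussianMGF X 1 μ)
    {lam : ℝ} (hl : |lam| ≤ 1 / 10) :
    ∫⁻ ω, ENNReal.ofReal (Real.exp (lam * (X ω ^ 2 - ∫ ω', X ω' ^ 2 ∂μ))) ∂μ ≤
      ENNReal.ofReal (Real.exp (178 * lam ^ 2)) := by
  set q := ∫ ω', X ω' ^ 2 ∂μ with hq
  have hq1 : q ≤ 1 := integral_sq_le_one h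
  have hq0 : 0 ≤ q := integral_nonneg fun _ => sq_nonneg _
  have hpt : ∀ ω, Real.exp (lam * (X ω ^ 2 - q)) ≤
      1 + lam * (X ω ^ 2 - q) + lam ^ 2 * (89 * (Real.exp (1 / 4) * Real.exp (X ω ^ 2 / 4))) := by
    intro ω
    refine (exp_mul_le_of_abs_le hl).trans ?_
    gcongr
    rw [← Real.exp_add, Real.exp_le_exp]
    have : |X ω ^ 2 - q| ≤ X ω ^ 2 + 1 := abs_le.2 ⟨by nlinarith [sq_nonneg (X ω)], by linarith⟩
    linarith
  have hi1 : Integrable (fun ω => 1 + lam * (X ω ^ 2 - q)) μ :=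
    (integrable_const _).add (((integrable_sq h).sub (integrable_const _)).const_mul _)
  have hi2 : Integrable
      (fun ω => lam ^ 2 * (89 * (Real.exp (1 / 4) * Real.exp (X ω ^ 2 / 4)))) μ :=
    (((integrable_exp_sq hX h).const_mul _).const_mul _).const_mul _
  calc _ ≤ ∫⁻ ω, ENNReal.ofReal (1 + lam * (X ω ^ 2 - q) +
          lam ^ 2 * (89 * (Real.exp (1 / 4) * Real.exp (X ω ^ 2 / 4)))) ∂μ :=
        lintegral_mono fun ω => ENNReal.ofReal_le_ofReal (hpt ω)
    _ = ENNReal.ofReal (∫ ω, (1 + lam * (X ω ^ 2 - q) +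
          lam ^ 2 * (89 * (Real.exp (1 / 4) * Real.exp (X ω ^ 2 / 4)))) ∂μ) :=
        (ofReal_integral_eq_lintegral_ofReal (hi1.add hi2)
          (ae_of_all _ fun ω => (Real.exp_pos _).le.trans (hpt ω))).symm
    _ ≤ _ := by
        refine ENNReal.ofReal_le_ofReal ?_
        have hi3 : ∫ ω, (1 + lam * (X ω ^ 2 - q)) ∂μ = 1 := by
          have hi4 : Integrable (fun ω => lam * (X ω ^ 2 - q)) μ :=
            ((integrable_sq h).sub (integrable_const _)).const_mul _
          rw [integral_add (integrable_const _) hi4, integral_const_mul,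
            integral_sub (integrable_sq h) (integrable_const _), ← hq]
          simp
        rw [integral_add hi1 hi2, hi3, integral_const_mul, integral_const_mul, integral_const_mul]
        have h1 := integral_exp_sq_le hX h
        have h2 : Real.exp (1 / 4) * √2 ≤ 2 := by
          have ha : √2 ≤ 1.42 := Real.sqrt_le_left (by norm_num) |>.mpr (by norm_num)
          have hb : Real.exp (1 / 4) ≤ 1.4 := by
            have h4 : Real.exp (1 / 4) ^ 4 = Real.exp 1 := by
              rw [← Real.exp_nat_mul]; norm_num
            by_contra! hc
            have : (1.4 : ℝ) ^ 4 < Real.exp (1 / 4) ^ 4 := by gcongr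
            rw [h4] at this
            have := Real.exp_one_lt_d9
            norm_num at *
            linarith
          nlinarith [Real.exp_pos (1 / 4), Real.sqrt_nonneg 2]
        have h3 := Real.add_one_le_exp (178 * lam ^ 2)
        have h4 := mul_le_mul_of_nonneg_left h1 (Real.exp_pos (1 / 4)).le
        nlinarith [mul_le_mul_of_nonneg_left (h4.trans h2) (sq_nonneg lam)]

end OneDim

/-! ### A Chernoff bound for product measures -/

theorem measure_pi_sum_gt_le {ι : Type*} [Fintype ι] {α : ι → Type*} [∀ i, MeasurableSpace (α i)]
    (ν : ∀ i, Measure (α i)) [∀ i, IsProbabilityMeasure (ν i)] (f : ∀ i, α i → ℝ)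
    (hf : ∀ i, Measurable (f i)) (c L : ℝ)
    (h : ∀ i, ∫⁻ y, ENNReal.ofReal (Real.exp (f i y)) ∂(ν i) ≤ ENNReal.ofReal (Real.exp c)) :
    Measure.pi ν {y | Fintype.card ι * c + L < ∑ i, f i (y i)} ≤
      ENNReal.ofReal (Real.exp (-L)) := by
  have hprod : ∫⁻ y, ENNReal.ofReal (Real.exp (∑ i, f i (y i))) ∂(Measure.pi ν) ≤
      ENNReal.ofReal (Real.exp (Fintype.card ι * c)) := by
    have hind := iIndepFun_pi (μ := ν) (X := fun i y => ENNReal.ofReal (Real.exp (f i y)))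
      fun i => (hf i).exp.ennreal_ofReal.aemeasurable
    have h1 := lintegral_prod_eq_prod_lintegral_of_indepFun Finset.univ _ hind
      fun i => (hf i).exp.ennreal_ofReal.comp (measurable_pi_apply i)
    simp_rw [Real.exp_sum, ENNReal.ofReal_prod_of_nonneg fun i _ => (Real.exp_pos _).le]
    rw [h1]
    calc _ ≤ ∏ _i : ι, ENNReal.ofReal (Real.exp c) := by
          refine Finset.prod_le_prod' fun i _ => ?_
          exact ((measurePreserving_eval ν i).lintegral_comp
            (f := fun y => ENNReal.ofReal (Real.exp (f i y))) (hf i).exp.ennreal_ofReal).trans_le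
            (h i)
      _ = _ := by
          rw [Finset.prod_const, Finset.card_univ, ← ENNReal.ofReal_pow (Real.exp_pos _).le,
            ← Real.exp_nat_mul]
  have hmeas : Measurable fun y : ∀ i, α i => ENNReal.ofReal (Real.exp (∑ i, f i (y i))) :=
    (Measurable.exp (Finset.measurable_sum _
      fun i _ => (hf i).comp (measurable_pi_apply i))).ennreal_ofReal
  have hmark := mul_meas_ge_le_lintegral (μ := Measure.pi ν) hmeas
    (ENNReal.ofReal (Real.exp (Fintype.card ι * c + L)))
  have hne : ENNReal.ofReal (Real.exp (Fintype.card ι * c + L)) ≠ 0 := by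
    simpa using Real.exp_pos _
  have hL : Real.exp (-L) =
      Real.exp (Fintype.card ι * c) / Real.exp (Fintype.card ι * c + L) := by
    rw [← Real.exp_sub]; ring_nf
  rw [hL, ENNReal.ofReal_div_of_pos (Real.exp_pos _),
    ENNReal.le_div_iff_mul_le (Or.inl hne) (Or.inl ENNReal.ofReal_ne_top), mul_comm]
  refine le_trans ?_ (hmark.trans hprod)
  gcongr
  intro hy
  exact ENNReal.ofReal_le_ofReal (Real.exp_le_exp.2 (le_of_lt hy))

/-! ### Finite test sets for norms -/

section Net

variable {E : Type*} [NormedAddCommGroup E] [InnerProductSpace ℝ E] [FiniteDimensional ℝ E]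

theorem exists_half_net (E : Type*) [NormedAddCommGroup E] [NormedSpace ℝ E]
    [FiniteDimensional ℝ E] :
    ∃ V : Finset E, V.card ≤ 5 ^ Module.finrank ℝ E ∧ (∀ v ∈ V, ‖v‖ ≤ 1) ∧
      ∀ x : E, ‖x‖ ≤ 1 → ∃ v ∈ V, ‖x - v‖ ≤ 1 / 2 := by
  classical
  -- A separated set of largest cardinality in the ball of radius 2 is automatically a net; halving
  -- it gives the net of the unit ball. Radius 2 and separation 1 match
  -- `Besicovitch.card_le_of_separated`.
  let P : ℕ → Prop := fun n => ∃ s : Finset E, s.card = n ∧ (∀ c ∈ s, ‖c‖ ≤ 2) ∧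
    ∀ c ∈ s, ∀ d ∈ s, c ≠ d → 1 ≤ ‖c - d‖
  have hP0 : P 0 := ⟨∅, by simp⟩
  obtain ⟨s, hs, hs2, hsep⟩ : P (Nat.findGreatest P (5 ^ Module.finrank ℝ E)) :=
    Nat.findGreatest_spec (Nat.zero_le _) hP0
  refine ⟨s.image fun c => (1 / 2 : ℝ) • c, ?_, ?_, ?_⟩
  · exact Finset.card_image_le.trans (hs ▸ Nat.findGreatest_le _)
  · simp only [Finset.mem_image, forall_exists_index, and_imp, forall_apply_eq_imp_iff₂]
    intro c hc
    rw [norm_smul]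
    norm_num
    linarith [hs2 c hc]
  · intro x hx
    by_contra! hcon
    have hfar : ∀ c ∈ s, 1 < ‖(2 : ℝ) • x - c‖ := by
      intro c hc
      have h1 := hcon _ (Finset.mem_image_of_mem _ hc)
      have h2 : (2 : ℝ) • x - c = (2 : ℝ) • (x - (1 / 2 : ℝ) • c) := by
        rw [smul_sub, smul_smul]; norm_num
      rw [h2, norm_smul]
      norm_num at h1 ⊢
      linarith
    have hx2 : (2 : ℝ) • x ∉ s := fun hmem => by
      have := hfar _ hmem
      rw [sub_self, norm_zero] at this
      linarith
    have hnew2 : ∀ c ∈ insert ((2 : ℝ) • x) s, ‖c‖ ≤ 2 := by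
      refine Finset.forall_mem_insert _ _ _ |>.2 ⟨?_, hs2⟩
      rw [norm_smul]; norm_num; linarith
    have hnewsep : ∀ c ∈ insert ((2 : ℝ) • x) s, ∀ d ∈ insert ((2 : ℝ) • x) s, c ≠ d →
        1 ≤ ‖c - d‖ := by
      intro c hc d hd hcd
      rcases Finset.mem_insert.1 hc with rfl | hc' <;> rcases Finset.mem_insert.1 hd with rfl | hd'
      · exact absurd rfl hcd
      · exact (hfar d hd').le
      · rw [norm_sub_rev]; exact (hfar c hc').le
      · exact hsep c hc' d hd' hcd
    have hP : P (insert ((2 : ℝ) • x) s).card := ⟨_, rfl, hnew2, hnewsep⟩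
    have h1 := Nat.le_findGreatest (Besicovitch.card_le_of_separated _ hnew2 hnewsep) hP
    rw [Finset.card_insert_of_notMem hx2] at h1
    omega

omit [FiniteDimensional ℝ E] in
-- Testing the unit vector along `S` against a nearby net point gives `‖S‖ ≤ a + ‖S‖ / 2`.
theorem norm_le_of_half_net {V : Finset E} (hV : ∀ x : E, ‖x‖ ≤ 1 → ∃ v ∈ V, ‖x - v‖ ≤ 1 / 2)
    (S : E) {a : ℝ} (ha : ∀ v ∈ V, ⟪S, v⟫ ≤ a) : ‖S‖ ≤ 2 * a := by
  rcases eq_or_ne S 0 with rfl | hS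
  · obtain ⟨v, hv, -⟩ := hV 0 (by simp)
    simpa using ha v hv
  have hpos : 0 < ‖S‖ := norm_pos_iff.2 hS
  obtain ⟨v, hv, hdist⟩ := hV (‖S‖⁻¹ • S) (by
    rw [norm_smul, norm_inv, norm_norm, inv_mul_cancel₀ hpos.ne'])
  have h1 : ⟪S, ‖S‖⁻¹ • S⟫ = ‖S‖ := by
    rw [inner_smul_right, real_inner_self_eq_norm_sq]
    field_simp
  have h2 : ⟪S, ‖S‖⁻¹ • S - v⟫ ≤ ‖S‖ * (1 / 2) :=
    (real_inner_le_norm _ _).trans (by gcongr)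
  rw [inner_sub_right, h1] at h2
  linarith [ha v hv]

omit [FiniteDimensional ℝ E] in
theorem opNorm_le_of_half_net {V : Finset E}
    (hV : ∀ x : E, ‖x‖ ≤ 1 → ∃ v ∈ V, ‖x - v‖ ≤ 1 / 2)
    (A : E →L[ℝ] E) {a : ℝ} (ha : ∀ v ∈ V, ‖A v‖ ≤ a) : ‖A‖ ≤ 2 * a := by
  have ha0 : 0 ≤ a := by
    obtain ⟨v, hv, -⟩ := hV 0 (by simp)
    exact (norm_nonneg _).trans (ha v hv)
  have h1 : ‖A‖ ≤ a + ‖A‖ * (1 / 2) := by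
    refine A.opNorm_le_of_unit_norm (by positivity) fun x hx => ?_
    obtain ⟨v, hv, hd⟩ := hV x hx.le
    calc ‖A x‖ = ‖A v + A (x - v)‖ := by rw [← map_add]; simp
      _ ≤ ‖A v‖ + ‖A (x - v)‖ := norm_add_le _ _
      _ ≤ a + ‖A‖ * (1 / 2) := by
        gcongr
        · exact ha v hv
        · exact (A.le_opNorm _).trans (by gcongr)
  linarith

/-- Polarisation: half-sums and half-differences of net points are added, so that bounds on the
quadratic form give `⟪A x, y⟫ ≤ 2a` on pairs of net points. Passing from the net to the ball in each
argument costs a factor 2, hence `8a`. -/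
theorem exists_test_set (E : Type*) [NormedAddCommGroup E] [InnerProductSpace ℝ E]
    [FiniteDimensional ℝ E] :
    ∃ V : Finset E, V.card ≤ 3 * 25 ^ Module.finrank ℝ E ∧ (∀ v ∈ V, ‖v‖ ≤ 1) ∧
      (∀ (S : E) (a : ℝ), (∀ v ∈ V, ⟪S, v⟫ ≤ a) → ‖S‖ ≤ 2 * a) ∧
      ∀ (A : E →L[ℝ] E) (a : ℝ), (∀ x y, ⟪A x, y⟫ = ⟪A y, x⟫) →
        (∀ v ∈ V, |⟪A v, v⟫| ≤ a) → ‖A‖ ≤ 8 * a := by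
  classical
  obtain ⟨V, hcard, hball, hnet⟩ := exists_half_net E
  refine ⟨V ∪ (((V ×ˢ V).image fun p => (1 / 2 : ℝ) • (p.1 + p.2)) ∪
    (V ×ˢ V).image fun p => (1 / 2 : ℝ) • (p.1 - p.2)), ?_, ?_, ?_, ?_⟩
  · have h25 : (V ×ˢ V).card ≤ 25 ^ Module.finrank ℝ E := by
      rw [Finset.card_product, show 25 = 5 * 5 by norm_num, mul_pow]
      exact Nat.mul_le_mul hcard hcard
    have h5 : 5 ^ Module.finrank ℝ E ≤ 25 ^ Module.finrank ℝ E :=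
      Nat.pow_le_pow_left (by norm_num) _
    calc _ ≤ V.card + ((V ×ˢ V).card + (V ×ˢ V).card) :=
          (Finset.card_union_le _ _).trans (add_le_add le_rfl ((Finset.card_union_le _ _).trans
            (add_le_add Finset.card_image_le Finset.card_image_le)))
      _ ≤ _ := by omega
  · intro v hv
    simp only [Finset.mem_union, Finset.mem_image, Finset.mem_product, Prod.exists] at hv
    rcases hv with hv | ⟨x, y, ⟨hx, hy⟩, rfl⟩ | ⟨x, y, ⟨hx, hy⟩, rfl⟩
    · exact hball v hv
    · have := norm_add_le x y
      rw [norm_smul]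
      norm_num
      linarith [hball x hx, hball y hy]
    · have := norm_sub_le x y
      rw [norm_smul]
      norm_num
      linarith [hball x hx, hball y hy]
  · exact fun S a ha => norm_le_of_half_net hnet S fun v hv => ha v (Finset.mem_union_left _ hv)
  · intro A a hsymm ha
    have hbil : ∀ x ∈ V, ∀ y ∈ V, ⟪A x, y⟫ ≤ 2 * a := by
      intro x hx y hy
      have h1 := ha ((1 / 2 : ℝ) • (x + y)) (Finset.mem_union_right _ (Finset.mem_union_left _
        (Finset.mem_image.2 ⟨(x, y), Finset.mem_product.2 ⟨hx, hy⟩, rfl⟩)))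
      have h2 := ha ((1 / 2 : ℝ) • (x - y)) (Finset.mem_union_right _ (Finset.mem_union_right _
        (Finset.mem_image.2 ⟨(x, y), Finset.mem_product.2 ⟨hx, hy⟩, rfl⟩)))
      have h3 := (abs_le.1 h1).2
      have h4 := (abs_le.1 h2).1
      simp only [map_smul, map_add, map_sub, inner_add_left, inner_add_right, inner_sub_left,
        inner_sub_right, real_inner_smul_left, real_inner_smul_right] at h3 h4
      rw [hsymm y x] at h3 h4
      linarith
    have h1 := opNorm_le_of_half_net hnet A fun x hx => norm_le_of_half_net hnet (A x) (hbil x hx)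
    linarith

end Net

/-! ### Regular samples -/

/-- The deviation bounds for a sample `y` in the directions `v ∈ V`: for the linear sums over the
sets `T k`, for the empirical second moment, and for the upper tail of the squares. -/
structure IsRegular {N d : ℕ} {κ : Type*} (V : Finset (EuclideanSpace ℝ (Fin d)))
    (T : κ → Finset (Fin N)) (ε η L : ℝ) (y : Fin N → EuclideanSpace ℝ (Fin d)) : Prop where
  linear : ∀ v ∈ V, ∀ k, ∑ i ∈ T k, ⟪y i, v⟫ ≤ 3 / 2 * √(N * L)
  upper : ∀ v ∈ V, ∑ i, ε * (⟪y i, v⟫ ^ 2 - η ^ 2 * ‖v‖ ^ 2) ≤ N * (178 * ε ^ 2) + L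
  lower : ∀ v ∈ V, ∑ i, -ε * (⟪y i, v⟫ ^ 2 - η ^ 2 * ‖v‖ ^ 2) ≤ N * (178 * ε ^ 2) + L
  tail : ∀ v ∈ V, ∑ i, 1 / 4 * max (⟪y i, v⟫ ^ 2 - 4 * Real.log (1 / ε)) 0 ≤ N * (2 * ε) + L

theorem isRegular_iff {N d : ℕ} {κ : Type*} {V : Finset (EuclideanSpace ℝ (Fin d))}
    {T : κ → Finset (Fin N)} {ε η L : ℝ} {y : Fin N → EuclideanSpace ℝ (Fin d)} :
    IsRegular V T ε η L y ↔ ∀ v ∈ V,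
      (∀ k, ∑ i ∈ T k, ⟪y i, v⟫ ≤ 3 / 2 * √(N * L)) ∧
      ∑ i, ε * (⟪y i, v⟫ ^ 2 - η ^ 2 * ‖v‖ ^ 2) ≤ N * (178 * ε ^ 2) + L ∧
      ∑ i, -ε * (⟪y i, v⟫ ^ 2 - η ^ 2 * ‖v‖ ^ 2) ≤ N * (178 * ε ^ 2) + L ∧
      ∑ i, 1 / 4 * max (⟪y i, v⟫ ^ 2 - 4 * Real.log (1 / ε)) 0 ≤ N * (2 * ε) + L :=
  ⟨fun ⟨h1, h2, h3, h4⟩ v hv => ⟨h1 v hv, h2 v hv, h3 v hv, h4 v hv⟩,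
    fun h => ⟨fun v hv => (h v hv).1, fun v hv => (h v hv).2.1, fun v hv => (h v hv).2.2.1,
      fun v hv => (h v hv).2.2.2⟩⟩

/-- The family `T` varies with the point because the presence sets depend on the adversary's seed.
-/
theorem measurableSet_isRegular {α : Type*} [MeasurableSpace α] {N d : ℕ} {κ : Type*} [Countable κ]
    (V : Finset (EuclideanSpace ℝ (Fin d))) (ε η L : ℝ)
    {T : α → κ → Finset (Fin N)} (hT : ∀ k i, MeasurableSet {a | i ∈ T a k})
    {Y : α → Fin N → EuclideanSpace ℝ (Fin d)} (hY : Measurable Y) :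
    MeasurableSet {a | IsRegular V (T a) ε η L (Y a)} := by
  classical
  simp only [isRegular_iff]
  have hin : ∀ i v, Measurable fun a => ⟪Y a i, v⟫ := fun i v =>
    ((measurable_pi_apply i).comp hY).inner measurable_const
  simp only [Set.ofPred_forall, Set.ofPred_and]
  refine Finset.measurableSet_biInter V fun v _ => ?_
  refine MeasurableSet.inter ?_ (MeasurableSet.inter ?_ (MeasurableSet.inter ?_ ?_))
  · refine MeasurableSet.iInter fun k => ?_
    have : ∀ a, ∑ i ∈ T a k, ⟪Y a i, v⟫ = ∑ i, if i ∈ T a k then ⟪Y a i, v⟫ else 0 := fun a => by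
      rw [Finset.sum_ite_mem, Finset.univ_inter]
    simp_rw [this]
    exact measurableSet_le (Finset.measurable_sum _ fun i _ =>
      Measurable.ite (hT k i) (hin i v) measurable_const) measurable_const
  · exact measurableSet_le (by fun_prop) measurable_const
  · exact measurableSet_le (by fun_prop) measurable_const
  · exact measurableSet_le (by fun_prop) measurable_const

/-- A centred distribution that is `1`-sub-Gaussian with covariance `η² I`, directionwise. -/
structure IsCenteredSubGaussian {d : ℕ} (η : ℝ) (ν : Measure (EuclideanSpace ℝ (Fin d))) :
    Prop where
  hasSubgaussianMGF : ∀ v, ‖v‖ ≤ 1 → HasSubgaussianMGF (fun y => ⟪y, v⟫) 1 ν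
  integral_sq : ∀ v, ∫ y, ⟪y, v⟫ ^ 2 ∂ν = η ^ 2 * ‖v‖ ^ 2

section Probability

variable {N d : ℕ} {η ε L : ℝ} {ν : Fin N → Measure (EuclideanSpace ℝ (Fin d))}
  [∀ i, IsProbabilityMeasure (ν i)]

/-- Chernoff with parameter `√(L/N)`, which balances `N lam²/2` against `L`. Indices outside `T`
contribute a factor 1, within the same budget, so the bound is the same for every `T`. -/
theorem measure_linear_gt_le (hN : 0 < N) (hν : ∀ i, IsCenteredSubGaussian η (ν i)) (hL : 0 < L)
    (T : Finset (Fin N)) {v : EuclideanSpace ℝ (Fin d)} (hv : ‖v‖ ≤ 1) :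
    Measure.pi ν {y | 3 / 2 * √(N * L) < ∑ i ∈ T, ⟪y i, v⟫} ≤ ENNReal.ofReal (Real.exp (-L)) := by
  classical
  have hN' : (0 : ℝ) < N := Nat.cast_pos.2 hN
  set lam : ℝ := √(L / N) with hlam
  have hlam0 : 0 < lam := by positivity
  have hsq : lam ^ 2 = L / N := Real.sq_sqrt (by positivity)
  have hmul : lam * √(N * L) = L := by
    rw [hlam, ← Real.sqrt_mul (by positivity), show L / N * (N * L) = L ^ 2 by field_simp,
      Real.sqrt_sq hL.le]
  refine le_trans (measure_mono ?_) (measure_pi_sum_gt_le ν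
    (fun i y => if i ∈ T then lam * ⟪y, v⟫ else 0) (fun i => ?_) (lam ^ 2 / 2) L fun i => ?_)
  · intro y hy
    simp only [Set.mem_ofPred_eq, Finset.sum_ite_mem, Finset.univ_inter, Fintype.card_fin] at hy ⊢
    rw [← Finset.mul_sum, hsq]
    have := mul_lt_mul_of_pos_left hy hlam0
    have h1 : (N : ℝ) * (L / N / 2) + L = 3 / 2 * L := by field_simp; ring
    rw [h1]
    linarith
  · split_ifs <;> fun_prop
  · have h := (hν i).hasSubgaussianMGF v hv
    split_ifs
    · rw [← ofReal_integral_eq_lintegral_ofReal (h.integrable_exp_mul _)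
        (ae_of_all _ fun _ => (Real.exp_pos _).le)]
      exact ENNReal.ofReal_le_ofReal ((h.mgf_le _).trans_eq (by simp))
    · simp only [Real.exp_zero, lintegral_const, measure_univ, mul_one]
      exact ENNReal.ofReal_le_ofReal (Real.one_le_exp (by positivity))

theorem measure_centered_sq_gt_le (hν : ∀ i, IsCenteredSubGaussian η (ν i)) {lam : ℝ}
    (hlam : |lam| ≤ 1 / 10) {v : EuclideanSpace ℝ (Fin d)} (hv : ‖v‖ ≤ 1) :
    Measure.pi ν {y | N * (178 * lam ^ 2) + L <
      ∑ i, lam * (⟪y i, v⟫ ^ 2 - η ^ 2 * ‖v‖ ^ 2)} ≤ ENNReal.ofReal (Real.exp (-L)) := by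
  have := measure_pi_sum_gt_le ν (fun _ y => lam * (⟪y, v⟫ ^ 2 - η ^ 2 * ‖v‖ ^ 2))
    (fun i => by fun_prop) (178 * lam ^ 2) L fun i => by
      rw [← (hν i).integral_sq v]
      exact lintegral_exp_centered_sq_le (by fun_prop) ((hν i).hasSubgaussianMGF v hv) hlam
  rwa [Fintype.card_fin] at this

theorem measure_tail_gt_le (hν : ∀ i, IsCenteredSubGaussian η (ν i)) (hε : 0 < ε)
    {v : EuclideanSpace ℝ (Fin d)} (hv : ‖v‖ ≤ 1) :
    Measure.pi ν {y | N * (2 * ε) + L <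
      ∑ i, 1 / 4 * max (⟪y i, v⟫ ^ 2 - 4 * Real.log (1 / ε)) 0} ≤
      ENNReal.ofReal (Real.exp (-L)) := by
  have := measure_pi_sum_gt_le ν (fun _ y => 1 / 4 * max (⟪y, v⟫ ^ 2 - 4 * Real.log (1 / ε)) 0)
    (fun i => by fun_prop) (2 * ε) L fun i => by
      have h := lintegral_exp_posPart_le (by fun_prop) ((hν i).hasSubgaussianMGF v hv)
        (4 * Real.log (1 / ε))
      have he : Real.exp (-(4 * Real.log (1 / ε)) / 4) = ε := by
        rw [one_div, Real.log_inv, show -(4 * -Real.log ε) / 4 = Real.log ε by ring,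
          Real.exp_log hε]
      rwa [he] at h
  rwa [Fintype.card_fin] at this

theorem measure_not_isRegular_le (hN : 0 < N) (hν : ∀ i, IsCenteredSubGaussian η (ν i))
    (hL : 0 < L) (hε : 0 < ε) (hε1 : ε ≤ 1 / 10) {V : Finset (EuclideanSpace ℝ (Fin d))}
    (hV : ∀ v ∈ V, ‖v‖ ≤ 1) {κ : Type*} [Fintype κ] (T : κ → Finset (Fin N)) :
    Measure.pi ν {y | ¬ IsRegular V T ε η L y} ≤
      V.card * ((Fintype.card κ + 3) * ENNReal.ofReal (Real.exp (-L))) := by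
  have hsub : {y | ¬ IsRegular V T ε η L y} ⊆ ⋃ v ∈ V,
      ((⋃ k ∈ Finset.univ, {y | 3 / 2 * √(N * L) < ∑ i ∈ T k, ⟪y i, v⟫}) ∪
      ({y | N * (178 * ε ^ 2) + L < ∑ i, ε * (⟪y i, v⟫ ^ 2 - η ^ 2 * ‖v‖ ^ 2)} ∪
      ({y | N * (178 * (-ε) ^ 2) + L < ∑ i, -ε * (⟪y i, v⟫ ^ 2 - η ^ 2 * ‖v‖ ^ 2)} ∪
      {y | N * (2 * ε) + L <
        ∑ i, 1 / 4 * max (⟪y i, v⟫ ^ 2 - 4 * Real.log (1 / ε)) 0}))) := by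
    intro y hy
    contrapose! hy
    simp only [Set.mem_iUnion, Set.mem_union, Set.mem_ofPred_eq, Finset.mem_univ, exists_prop,
      true_and, not_exists, not_and, not_or, not_lt, not_not, neg_sq] at hy ⊢
    exact isRegular_iff.2 hy
  have habs : |ε| ≤ 1 / 10 := by rwa [abs_of_pos hε]
  refine (measure_mono hsub).trans ((measure_biUnion_finset_le V _).trans ?_)
  refine (Finset.sum_le_card_nsmul V _ _ fun v hv => ?_).trans_eq (nsmul_eq_mul _ _)
  have h1 : Measure.pi ν (⋃ k ∈ Finset.univ, {y | 3 / 2 * √(N * L) < ∑ i ∈ T k, ⟪y i, v⟫}) ≤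
      Fintype.card κ * ENNReal.ofReal (Real.exp (-L)) := by
    refine (measure_biUnion_finset_le _ _).trans ?_
    rw [← Finset.card_univ]
    exact (Finset.sum_le_card_nsmul Finset.univ _ _ fun k _ =>
      measure_linear_gt_le hN hν hL (T k) (hV v hv)).trans_eq (nsmul_eq_mul _ _)
  refine (measure_union_le _ _).trans ?_
  rw [add_mul]
  refine add_le_add h1 ((measure_union_le _ _).trans ?_)
  rw [show (3 : ENNReal) = 1 + (1 + 1) by norm_num, add_mul, add_mul, one_mul]
  exact add_le_add (measure_centered_sq_gt_le hν habs (hV v hv))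
    ((measure_union_le _ _).trans (add_le_add
      (measure_centered_sq_gt_le hν (by rwa [abs_neg]) (hV v hv))
      (measure_tail_gt_le hν hε (hV v hv))))

/-- The factor 10 does the work: `50 · exp (-10) ≤ 1` beats both `25 ^ d` and `d + 4 ≤ 4 · 2 ^ d`,
while `δ ^ 9 ≤ 2⁻⁹` absorbs the remaining constant 12. -/
theorem card_mul_exp_neg_le {δ : ℝ} (hδ : 0 < δ) (hδ1 : δ < 1 / 2) (d : ℕ) :
    3 * 25 ^ d * ((d + 1 + 3) * Real.exp (-(10 * (d + Real.log (1 / δ))))) ≤ δ := by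
  have h1 : Real.exp (-(10 * (d + Real.log (1 / δ)))) = Real.exp (-1) ^ (10 * d) * δ ^ 10 := by
    have : δ ^ 10 = Real.exp (10 * Real.log δ) := by
      rw [show (10 : ℝ) * Real.log δ = (10 : ℕ) * Real.log δ by norm_num, Real.exp_nat_mul,
        Real.exp_log hδ]
    rw [this, ← Real.exp_nat_mul, ← Real.exp_add, one_div, Real.log_inv]
    push_cast
    ring_nf
  set q := Real.exp (-1) with hq
  have hq0 : 0 < q := Real.exp_pos _
  have hq2 : q ≤ 1 / 2 := by
    rw [hq, Real.exp_neg, inv_eq_one_div]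
    exact one_div_le_one_div_of_le (by norm_num) (by linarith [Real.add_one_le_exp (1 : ℝ)])
  have hd : ((d : ℝ) + 1 + 3) ≤ 4 * 2 ^ d := by
    have : (d : ℝ) + 1 ≤ 2 ^ d := by exact_mod_cast Nat.lt_two_pow_self
    have h2 : (1 : ℝ) ≤ 2 ^ d := one_le_pow₀ (by norm_num)
    linarith
  have hqd : (25 : ℝ) ^ d * 2 ^ d * q ^ (10 * d) ≤ 1 := by
    rw [pow_mul, ← mul_pow, ← mul_pow]
    refine pow_le_one₀ (by positivity) ?_
    have : q ^ 10 ≤ (1 / 2) ^ 10 := by gcongr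
    norm_num at this
    linarith
  have hδ9 : δ ^ 9 ≤ (1 / 2) ^ 9 := by gcongr
  rw [h1]
  calc 3 * 25 ^ d * (((d : ℝ) + 1 + 3) * (q ^ (10 * d) * δ ^ 10))
      ≤ 3 * 25 ^ d * ((4 * 2 ^ d) * (q ^ (10 * d) * δ ^ 10)) := by gcongr
    _ = 12 * (25 ^ d * 2 ^ d * q ^ (10 * d)) * (δ ^ 9 * δ) := by ring
    _ ≤ 12 * 1 * ((1 / 2) ^ 9 * δ) := by gcongr
    _ ≤ δ := by norm_num; linarith

theorem measure_not_isRegular_le_ofReal (hN : 0 < N) (hν : ∀ i, IsCenteredSubGaussian η (ν i))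
    {δ : ℝ} (hδ : 0 < δ) (hδ1 : δ < 1 / 2) (hε : 0 < ε) (hε1 : ε ≤ 1 / 10)
    {V : Finset (EuclideanSpace ℝ (Fin d))} (hVcard : V.card ≤ 3 * 25 ^ d)
    (hV : ∀ v ∈ V, ‖v‖ ≤ 1) (T : Option (Fin d) → Finset (Fin N)) :
    Measure.pi ν {y | ¬ IsRegular V T ε η (10 * (d + Real.log (1 / δ))) y} ≤
      ENNReal.ofReal δ := by
  have hlog : 0 < Real.log (1 / δ) := Real.log_pos (by rw [lt_div_iff₀ hδ]; linarith)
  refine (measure_not_isRegular_le hN hν (by positivity) hε hε1 hV T).trans ?_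
  refine le_trans ?_ (ENNReal.ofReal_le_ofReal (card_mul_exp_neg_le hδ hδ1 d))
  have h1 : (V.card : ENNReal) ≤ ENNReal.ofReal (3 * 25 ^ d) := by
    rw [← ENNReal.ofReal_natCast]
    exact ENNReal.ofReal_le_ofReal (by exact_mod_cast hVcard)
  have h2 : ((Fintype.card (Option (Fin d)) : ENNReal) + 3) = ENNReal.ofReal (d + 1 + 3) := by
    rw [Fintype.card_option, Fintype.card_fin, ENNReal.ofReal_add (by positivity) (by norm_num),
      ENNReal.ofReal_add (by positivity) (by norm_num)]
    simp
  rw [ENNReal.ofReal_mul (p := 3 * 25 ^ d) (by positivity),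
    ENNReal.ofReal_mul (p := d + 1 + 3) (by positivity), h2]
  gcongr

end Probability

/-! ### Deterministic consequences of regularity -/

theorem toEuclideanCLM_sum_outer_apply {N d : ℕ} (w : Fin N → ℝ)
    (y : Fin N → EuclideanSpace ℝ (Fin d)) (c : ℝ) (x : EuclideanSpace ℝ (Fin d)) :
    Matrix.toEuclideanCLM (n := Fin d) (𝕜 := ℝ) ((∑ i, w i • outer (y i)) - c • 1) x =
      (∑ i, (w i * ⟪y i, x⟫) • y i) - c • x := by
  have hout : ∀ z : EuclideanSpace ℝ (Fin d),
      Matrix.toEuclideanCLM (n := Fin d) (𝕜 := ℝ) (outer z) x = ⟪z, x⟫ • z := by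
    intro z
    ext j
    simp only [Matrix.ofLp_toEuclideanCLM, Matrix.mulVec, dotProduct, outer, Matrix.of_apply,
      PiLp.smul_apply, smul_eq_mul, PiLp.inner_apply, RCLike.inner_apply, conj_trivial,
      Finset.sum_mul]
    exact Finset.sum_congr rfl fun k _ => by ring
  rw [map_sub, map_sum, map_smul, map_one]
  simp only [map_smul, sub_apply, sum_apply, smul_apply, hout, smul_smul,
    one_apply_eq_self]

theorem inner_toEuclideanCLM_sum_outer {N d : ℕ} (w : Fin N → ℝ)
    (y : Fin N → EuclideanSpace ℝ (Fin d)) (c : ℝ) (x z : EuclideanSpace ℝ (Fin d)) :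
    ⟪Matrix.toEuclideanCLM (n := Fin d) (𝕜 := ℝ) ((∑ i, w i • outer (y i)) - c • 1) x, z⟫ =
      (∑ i, w i * ⟪y i, x⟫ * ⟪y i, z⟫) - c * ⟪x, z⟫ := by
  rw [toEuclideanCLM_sum_outer_apply, inner_sub_left, sum_inner, real_inner_smul_left]
  simp only [real_inner_smul_left]

/-- Bounded weights are close in `ℓ¹` to the uniform weights. -/
theorem abs_sub_uniform_le {N : ℕ} (hN : 0 < N) {ε : ℝ} (hε : 0 < ε) (hε1 : ε ≤ 1 / 10)
    {w : Fin N → ℝ} (h0 : ∀ i, 0 ≤ w i) (h1 : ∑ i, w i = 1)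
    (hw : ∀ i, w i ≤ 1 / ((1 - 3 * ε) * N)) :
    (∀ i, |w i - 1 / N| ≤ 1 / N) ∧ ∑ i, |w i - 1 / N| ≤ 10 * ε := by
  have hN' : (0 : ℝ) < N := Nat.cast_pos.2 hN
  have hw' : ∀ i, w i - 1 / N ≤ 5 * ε / N := by
    intro i
    -- `(1 + 5ε)(1 - 3ε) = 1 + 2ε - 15ε² ≥ 1` for `ε ≤ 2/15`.
    have : 1 / ((1 - 3 * ε) * N) ≤ (1 + 5 * ε) / N := by
      rw [div_le_div_iff₀ (mul_pos (by linarith) hN') hN', ← mul_assoc]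
      exact mul_le_mul_of_nonneg_right (by nlinarith) hN'.le
    have h2 := (hw i).trans this
    rw [add_div] at h2
    linarith
  have hNinv : 0 < 1 / (N : ℝ) := by positivity
  have h5 : 5 * ε / N ≤ 1 / N := by gcongr; linarith
  refine ⟨fun i => abs_le.2 ⟨by linarith [h0 i], (hw' i).trans h5⟩, ?_⟩
  -- A number `x ≤ c` with `c ≥ 0` satisfies `|x| ≤ 2c - x`; the deviations sum to zero, so
  -- one-sided bounds suffice for the `ℓ¹` bound.
  have habs : ∀ i, |w i - 1 / N| ≤ 2 * (5 * ε / N) - (w i - 1 / N) := by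
    intro i
    have : 0 ≤ 5 * ε / N := by positivity
    exact abs_le.2 ⟨by linarith, by linarith [hw' i]⟩
  refine (Finset.sum_le_sum fun i _ => habs i).trans_eq ?_
  rw [Finset.sum_sub_distrib, Finset.sum_sub_distrib, h1]
  simp only [Finset.sum_const, Finset.card_univ, Fintype.card_fin, nsmul_eq_mul]
  field_simp
  ring

section Regular

variable {N d : ℕ} {κ : Type*} {V : Finset (EuclideanSpace ℝ (Fin d))} {T : κ → Finset (Fin N)}
  {ε η L : ℝ} {y : Fin N → EuclideanSpace ℝ (Fin d)} {w : Fin N → ℝ}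

theorem le_mul_log_one_div (hε : 0 < ε) (hε1 : ε ≤ 1 / 10) : ε ≤ ε * Real.log (1 / ε) := by
  have : 1 ≤ Real.log (1 / ε) := by
    rw [Real.le_log_iff_exp_le (by positivity), le_div_iff₀ hε]
    nlinarith [Real.exp_one_lt_d9, Real.exp_pos 1]
  nlinarith

/-- Split each square at `t = 4 log (1/ε)`. The part below costs `t` times the total mass `10ε`; the
excess is charged at the maximal weight `1/N` and bounded by the tail condition. -/
theorem IsRegular.sum_abs_mul_sq_le (h : IsRegular V T ε η L y) (hN : 0 < N) (hε : 0 < ε)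
    (hε1 : ε ≤ 1 / 10) (hL : 0 < L) {u : Fin N → ℝ} (hu0 : ∀ i, 0 ≤ u i)
    (hu1 : ∀ i, u i ≤ 1 / N) (hu : ∑ i, u i ≤ 10 * ε) {v : EuclideanSpace ℝ (Fin d)}
    (hv : v ∈ V) :
    ∑ i, u i * ⟪y i, v⟫ ^ 2 ≤ 49 * (L / (N * ε) + ε * Real.log (1 / ε)) := by
  have hN' : (0 : ℝ) < N := Nat.cast_pos.2 hN
  have hlog := le_mul_log_one_div hε hε1
  have hlog0 : 0 ≤ Real.log (1 / ε) := Real.log_nonneg (by rw [le_div_iff₀ hε]; linarith)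
  set t := 4 * Real.log (1 / ε) with ht
  have ht0 : 0 ≤ t := by positivity
  have hpt : ∀ i, u i * ⟪y i, v⟫ ^ 2 ≤
      t * u i + 4 / N * (1 / 4 * max (⟪y i, v⟫ ^ 2 - t) 0) := by
    intro i
    have h1 : ⟪y i, v⟫ ^ 2 ≤ t + max (⟪y i, v⟫ ^ 2 - t) 0 := by
      linarith [le_max_left (⟪y i, v⟫ ^ 2 - t) 0]
    have h2 : u i * max (⟪y i, v⟫ ^ 2 - t) 0 ≤ 1 / N * max (⟪y i, v⟫ ^ 2 - t) 0 :=
      mul_le_mul_of_nonneg_right (hu1 i) (le_max_right _ _)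
    calc u i * ⟪y i, v⟫ ^ 2 ≤ u i * (t + max (⟪y i, v⟫ ^ 2 - t) 0) :=
          mul_le_mul_of_nonneg_left h1 (hu0 i)
      _ ≤ u i * t + 1 / N * max (⟪y i, v⟫ ^ 2 - t) 0 := by rw [mul_add]; gcongr
      _ = _ := by ring
  have h3 := h.tail v hv
  calc ∑ i, u i * ⟪y i, v⟫ ^ 2 ≤ t * ∑ i, u i +
        4 / N * ∑ i, 1 / 4 * max (⟪y i, v⟫ ^ 2 - t) 0 := by
        rw [Finset.mul_sum, Finset.mul_sum, ← Finset.sum_add_distrib]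
        exact Finset.sum_le_sum fun i _ => hpt i
    _ ≤ t * (10 * ε) + 4 / N * (N * (2 * ε) + L) := by gcongr
    _ = 40 * (ε * Real.log (1 / ε)) + 8 * ε + 4 * (L / (N * ε)) * ε := by
        rw [ht]; field_simp; ring
    _ ≤ _ := by
        have h4 : 0 ≤ L / (N * ε) := by positivity
        nlinarith

/-- Uniform average plus deviation. Regularity uses Chernoff parameter `±ε`, so dividing by `N ε`
gives `178 ε + L / (N ε)`; with 49 from the deviation, the constant is `178 + 49`. -/
theorem IsRegular.abs_quadratic_le (h : IsRegular V T ε η L y) (hN : 0 < N) (hε : 0 < ε)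
    (hε1 : ε ≤ 1 / 10) (hL : 0 < L) (h0 : ∀ i, 0 ≤ w i) (h1 : ∑ i, w i = 1)
    (hw : ∀ i, w i ≤ 1 / ((1 - 3 * ε) * N)) {v : EuclideanSpace ℝ (Fin d)} (hv : v ∈ V) :
    |∑ i, w i * ⟪y i, v⟫ * ⟪y i, v⟫ - η ^ 2 * ⟪v, v⟫| ≤
      227 * (L / (N * ε) + ε * Real.log (1 / ε)) := by
  have hN' : (0 : ℝ) < N := Nat.cast_pos.2 hN
  obtain ⟨hu1, hu⟩ := abs_sub_uniform_le hN hε hε1 h0 h1 hw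
  have hlog := le_mul_log_one_div hε hε1
  have hA := h.sum_abs_mul_sq_le hN hε hε1 hL (fun i => abs_nonneg _) hu1 hu hv
  have hsplit : ∑ i, w i * ⟪y i, v⟫ * ⟪y i, v⟫ - η ^ 2 * ⟪v, v⟫ =
      1 / N * ∑ i, (⟪y i, v⟫ ^ 2 - η ^ 2 * ‖v‖ ^ 2) + ∑ i, (w i - 1 / N) * ⟪y i, v⟫ ^ 2 := by
    rw [Finset.sum_sub_distrib, real_inner_self_eq_norm_sq]
    simp only [sub_mul, Finset.sum_sub_distrib, ← Finset.mul_sum, Finset.sum_const,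
      Finset.card_univ, Fintype.card_fin, nsmul_eq_mul, mul_assoc, ← sq]
    field_simp
    ring
  have hup := h.upper v hv
  have hlow := h.lower v hv
  rw [← Finset.mul_sum] at hup hlow
  set Q := ∑ i, (⟪y i, v⟫ ^ 2 - η ^ 2 * ‖v‖ ^ 2)
  have hQ : |1 / N * Q| ≤ 178 * ε + L / (N * ε) := by
    have h2 : |ε * Q| ≤ N * (178 * ε ^ 2) + L := abs_le.2 ⟨by linarith, hup⟩
    have h3 : 1 / N * Q = (1 / (N * ε)) * (ε * Q) := by field_simp
    rw [h3, abs_mul, abs_of_pos (by positivity : 0 < 1 / (N * ε))]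
    refine (mul_le_mul_of_nonneg_left h2 (by positivity)).trans_eq ?_
    field_simp
  have hR : |∑ i, (w i - 1 / N) * ⟪y i, v⟫ ^ 2| ≤ ∑ i, |w i - 1 / N| * ⟪y i, v⟫ ^ 2 := by
    refine (Finset.abs_sum_le_sum_abs _ _).trans_eq (Finset.sum_congr rfl fun i _ => ?_)
    rw [abs_mul, abs_of_nonneg (sq_nonneg ⟪y i, v⟫)]
  rw [hsplit]
  have h4 : 0 ≤ L / (N * ε) := by positivity
  exact (abs_add_le _ _).trans (by linarith)

/-- The uniform part contributes `3/2`. The deviation is bounded over all indices by Cauchy–Schwarz: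
`10ε · 49b ≤ (45/2)² ε b`. The total is 24. -/
theorem IsRegular.linear_le (h : IsRegular V T ε η L y) (hN : 0 < N) (hε : 0 < ε)
    (hε1 : ε ≤ 1 / 10) (hL : 0 < L) (h0 : ∀ i, 0 ≤ w i) (h1 : ∑ i, w i = 1)
    (hw : ∀ i, w i ≤ 1 / ((1 - 3 * ε) * N)) {v : EuclideanSpace ℝ (Fin d)} (hv : v ∈ V) (k : κ) :
    ⟪∑ i ∈ T k, w i • y i, v⟫ ≤ 24 * √(ε * (L / (N * ε) + ε * Real.log (1 / ε))) := by
  have hN' : (0 : ℝ) < N := Nat.cast_pos.2 hN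
  obtain ⟨hu1, hu⟩ := abs_sub_uniform_le hN hε hε1 h0 h1 hw
  have hA := h.sum_abs_mul_sq_le hN hε hε1 hL (fun i => abs_nonneg _) hu1 hu hv
  have hlog0 : 0 ≤ Real.log (1 / ε) := Real.log_nonneg (by rw [le_div_iff₀ hε]; linarith)
  set b := L / (N * ε) + ε * Real.log (1 / ε) with hb
  have hb0 : 0 ≤ b := by positivity
  have hsplit : ⟪∑ i ∈ T k, w i • y i, v⟫ =
      1 / N * ∑ i ∈ T k, ⟪y i, v⟫ + ∑ i ∈ T k, (w i - 1 / N) * ⟪y i, v⟫ := by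
    rw [sum_inner, Finset.mul_sum, ← Finset.sum_add_distrib]
    exact Finset.sum_congr rfl fun i _ => by rw [real_inner_smul_left]; ring
  have hlin : 1 / N * ∑ i ∈ T k, ⟪y i, v⟫ ≤ 3 / 2 * √(ε * b) := by
    have h2 : √(N * L) = N * √(L / N) := by
      rw [show (N : ℝ) * L = N ^ 2 * (L / N) by field_simp, Real.sqrt_mul (by positivity),
        Real.sqrt_sq hN'.le]
    have h3 : √(L / N) ≤ √(ε * b) := by
      refine Real.sqrt_le_sqrt ?_
      have : ε * b = L / N + ε * (ε * Real.log (1 / ε)) := by rw [hb]; field_simp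
      rw [this]
      have : 0 ≤ ε * (ε * Real.log (1 / ε)) := by positivity
      linarith
    calc 1 / N * ∑ i ∈ T k, ⟪y i, v⟫ ≤ 1 / N * (3 / 2 * √(N * L)) := by
          gcongr; exact h.linear v hv k
      _ = 3 / 2 * √(L / N) := by rw [h2]; field_simp
      _ ≤ _ := by gcongr
  have hdev : ∑ i ∈ T k, (w i - 1 / N) * ⟪y i, v⟫ ≤ 45 / 2 * √(ε * b) := by
    have h4 : ∑ i ∈ T k, (w i - 1 / N) * ⟪y i, v⟫ ≤ ∑ i, |w i - 1 / N| * |⟪y i, v⟫| := by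
      refine (Finset.sum_le_sum fun i _ => (le_abs_self _).trans_eq (abs_mul _ _)).trans ?_
      exact Finset.sum_le_sum_of_subset_of_nonneg (Finset.subset_univ _)
        fun i _ _ => by positivity
    have h5 : (∑ i, |w i - 1 / N| * |⟪y i, v⟫|) ^ 2 ≤
        (∑ i, |w i - 1 / N|) * ∑ i, |w i - 1 / N| * ⟪y i, v⟫ ^ 2 := by
      refine Finset.sum_sq_le_sum_mul_sum_of_sq_le_mul _ (fun i _ => abs_nonneg _)
        (fun i _ => by positivity) fun i _ => Eq.le ?_
      rw [mul_pow, sq_abs ⟪y i, v⟫]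
      ring
    have h6 : (∑ i, |w i - 1 / N| * |⟪y i, v⟫|) ^ 2 ≤ (45 / 2 * √(ε * b)) ^ 2 := by
      rw [mul_pow, Real.sq_sqrt (by positivity)]
      have h7 : (∑ i, |w i - 1 / N|) * ∑ i, |w i - 1 / N| * ⟪y i, v⟫ ^ 2 ≤
          10 * ε * (49 * b) := by gcongr
      nlinarith [mul_nonneg hε.le hb0]
    exact h4.trans (pow_le_pow_iff_left₀ (by positivity) (by positivity) two_ne_zero |>.1 h6)
  rw [hsplit]
  linarith

end Regular

/-! ### The law of an example with its missing entries replaced by Gaussian noise -/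

section Directions

variable {d : ℕ} {η : ℝ}

theorem hasSubgaussianMGF_mono {Ω : Type*} [MeasurableSpace Ω] {μ : Measure Ω} {X : Ω → ℝ}
    {c c' : NNReal} (h : HasSubgaussianMGF X c μ) (hc : c ≤ c') : HasSubgaussianMGF X c' μ where
  integrable_exp_mul := h.integrable_exp_mul
  mgf_le t := (h.mgf_le t).trans (Real.exp_le_exp.2 (by gcongr))

theorem hasSubgaussianMGF_inner_sub_mean {D : Measure (EuclideanSpace ℝ (Fin d))}
    (hD : D ∈ classP1 d η) (v : EuclideanSpace ℝ (Fin d)) :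
    HasSubgaussianMGF (fun x => ⟪x - ∫ y, y ∂D, v⟫) (‖v‖₊ ^ 2) D where
  integrable_exp_mul t := by
    simpa only [real_inner_smul_right] using (hD.2.1.2 (t • v)).1
  mgf_le t := by
    have h := (hD.2.1.2 (t • v)).2
    simp only [real_inner_smul_right, norm_smul, mul_pow, Real.norm_eq_abs, sq_abs] at h
    refine h.trans_eq ?_
    simp only [NNReal.coe_pow, coe_nnnorm]
    ring_nf

theorem integral_inner_sub_mean {D : Measure (EuclideanSpace ℝ (Fin d))}
    (hD : D ∈ classP1 d η) (v : EuclideanSpace ℝ (Fin d)) :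
    ∫ x, ⟪x - ∫ y, y ∂D, v⟫ ∂D = 0 := by
  have := hD.1
  have hi : Integrable (fun x => x - ∫ y, y ∂D) D := hD.2.1.1.sub (integrable_const _)
  have h : ∫ x, (x - ∫ y, y ∂D) ∂D = 0 := by
    rw [integral_sub hD.2.1.1 (integrable_const _)]
    simp
  simp_rw [real_inner_comm v]
  rw [integral_inner hi, h, inner_zero_right]

theorem memLp_coord {D : Measure (EuclideanSpace ℝ (Fin d))} (hD : D ∈ classP1 d η) (j : Fin d) :
    MemLp (fun x : EuclideanSpace ℝ (Fin d) => x j) 2 D := by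
  have := hD.1
  have h := (hasSubgaussianMGF_inner_sub_mean hD (EuclideanSpace.single j 1)).memLp 2
  have h2 := h.add (memLp_const ((∫ y, y ∂D) j))
  refine h2.ae_eq (ae_of_all _ fun x => ?_)
  simp [EuclideanSpace.inner_single_right]

theorem variance_inner_sub_mean {D : Measure (EuclideanSpace ℝ (Fin d))}
    (hD : D ∈ classP1 d η) (v : EuclideanSpace ℝ (Fin d)) :
    Var[fun x => ⟪x - ∫ y, y ∂D, v⟫; D] = η ^ 2 * ‖v‖ ^ 2 := by
  have := hD.1
  have hcov : ∀ j k : Fin d, cov[fun x : EuclideanSpace ℝ (Fin d) => x j, fun x => x k; D] =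
      η ^ 2 * if j = k then 1 else 0 := by
    intro j k
    have h := congrFun (congrFun hD.2.2 j) k
    simpa [covMatrix, Matrix.one_apply] using h
  have hLp : ∀ j, MemLp (fun x : EuclideanSpace ℝ (Fin d) => v j * x j) 2 D :=
    fun j => (memLp_coord hD j).const_mul _
  have h1 : ∀ x : EuclideanSpace ℝ (Fin d),
      ⟪x - ∫ y, y ∂D, v⟫ = (∑ j, v j * x j) - ⟪∫ y, y ∂D, v⟫ := by
    intro x
    rw [inner_sub_left]
    simp [PiLp.inner_apply]
  simp_rw [h1]
  rw [variance_sub_const (memLp_finsetSum _ fun j _ => hLp j).aestronglyMeasurable,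
    variance_fun_sum hLp]
  simp_rw [covariance_const_mul_left, covariance_const_mul_right, hcov]
  rw [EuclideanSpace.real_norm_sq_eq, Finset.mul_sum]
  refine Finset.sum_congr rfl fun j _ => ?_
  simp
  ring

/-- This makes the `N(0, η²)` fill 1-sub-Gaussian as well. A coordinate `j` is needed: in dimension
0 the class does not constrain `η`. -/
theorem sq_le_one_of_mem_classP1 {D : Measure (EuclideanSpace ℝ (Fin d))}
    (hD : D ∈ classP1 d η) (j : Fin d) : η ^ 2 ≤ 1 := by
  have := hD.1
  set e : EuclideanSpace ℝ (Fin d) := EuclideanSpace.single j 1 with he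
  have hnorm : ‖e‖ = 1 := by simp [he]
  have h1 : HasSubgaussianMGF (fun x => ⟪x - ∫ y, y ∂D, e⟫) 1 D :=
    hasSubgaussianMGF_mono (hasSubgaussianMGF_inner_sub_mean hD e) (by
      rw [← NNReal.coe_le_coe]; simp [hnorm])
  have h2 := variance_inner_sub_mean hD e
  rw [variance_of_integral_eq_zero (by fun_prop) (integral_inner_sub_mean hD e), hnorm] at h2
  have h3 := integral_sq_le_one h1
  linarith

theorem hasSubgaussianMGF_gaussian_sum (hη : ∀ _ : Fin d, η ^ 2 ≤ 1)
    (v : EuclideanSpace ℝ (Fin d)) :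
    HasSubgaussianMGF (fun g : Fin d → ℝ => ∑ j, v j * g j) (‖v‖₊ ^ 2)
      (Measure.pi fun _ => gaussianReal 0 (η ^ 2).toNNReal) := by
  have h1 : ∀ j : Fin d, HasSubgaussianMGF (fun x : ℝ => v j * x) (‖v j‖₊ ^ 2)
      (gaussianReal 0 (η ^ 2).toNNReal) := by
    intro j
    refine hasSubgaussianMGF_mono (HasSubgaussianMGF.const_mul (c := (η ^ 2).toNNReal)
      ⟨fun t => integrable_exp_mul_gaussianReal t, fun t => ?_⟩ _) ?_
    · rw [mgf_fun_id_gaussianReal]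
      simp
    · rw [← NNReal.coe_le_coe]
      change v j ^ 2 * ((η ^ 2).toNNReal : ℝ) ≤ ‖v j‖ ^ 2
      rw [Real.coe_toNNReal _ (sq_nonneg _), Real.norm_eq_abs, sq_abs]
      exact mul_le_of_le_one_right (sq_nonneg _) (hη j)
  have h2 : ∀ j ∈ (Finset.univ : Finset (Fin d)),
      HasSubgaussianMGF (fun g : Fin d → ℝ => v j * g j) (‖v j‖₊ ^ 2)
      (Measure.pi fun _ : Fin d => gaussianReal 0 (η ^ 2).toNNReal) := by
    intro j _
    refine HasSubgaussianMGF.of_map (X := fun x : ℝ => v j * x)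
      (Y := fun g : Fin d → ℝ => g j) (measurable_pi_apply j).aemeasurable ?_
    rw [(measurePreserving_eval (fun _ : Fin d => gaussianReal 0 (η ^ 2).toNNReal) j).map_eq]
    exact h1 j
  have h3 := HasSubgaussianMGF.sum_of_iIndepFun
    (iIndepFun_pi (μ := fun _ : Fin d => gaussianReal 0 (η ^ 2).toNNReal)
      (X := fun j x => v j * x) fun j => by fun_prop) h2
  refine hasSubgaussianMGF_mono h3 ?_
  rw [← NNReal.coe_le_coe]
  push_cast
  rw [EuclideanSpace.norm_sq_eq]

theorem integral_gaussian_sum (v : EuclideanSpace ℝ (Fin d)) :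
    ∫ g : Fin d → ℝ, ∑ j, v j * g j ∂(Measure.pi fun _ => gaussianReal 0 (η ^ 2).toNNReal) = 0 := by
  have hmap : ∀ j : Fin d, (Measure.pi fun _ : Fin d => gaussianReal 0 (η ^ 2).toNNReal).map
      (fun g => g j) = gaussianReal 0 (η ^ 2).toNNReal := fun j =>
    (measurePreserving_eval (fun _ : Fin d => gaussianReal 0 (η ^ 2).toNNReal) j).map_eq
  have hid : Integrable (fun x : ℝ => x) (gaussianReal 0 (η ^ 2).toNNReal) :=
    (memLp_id_gaussianReal 1).integrable (by norm_num)
  have hi : ∀ j : Fin d, Integrable (fun g : Fin d → ℝ => g j)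
      (Measure.pi fun _ => gaussianReal 0 (η ^ 2).toNNReal) := fun j =>
    Integrable.comp_measurable (g := fun x : ℝ => x) (by rwa [hmap j]) (measurable_pi_apply j)
  rw [integral_finsetSum _ fun j _ => (hi j).const_mul _]
  refine Finset.sum_eq_zero fun j _ => ?_
  have h := integral_map (μ := Measure.pi fun _ : Fin d => gaussianReal 0 (η ^ 2).toNNReal)
    (measurable_pi_apply j).aemeasurable (f := fun x : ℝ => x) aestronglyMeasurable_id
  rw [hmap j, integral_id_gaussianReal] at h
  rw [integral_const_mul, ← h, mul_zero]

theorem variance_gaussian_sum (v : EuclideanSpace ℝ (Fin d)) :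
    Var[fun g : Fin d → ℝ => ∑ j, v j * g j;
      Measure.pi fun _ => gaussianReal 0 (η ^ 2).toNNReal] = η ^ 2 * ‖v‖ ^ 2 := by
  have h := variance_sum_pi (μ := fun _ : Fin d => gaussianReal 0 (η ^ 2).toNNReal)
    (X := fun j x => v j * x) fun j => (memLp_id_gaussianReal 2).const_mul _
  have h2 : (∑ j : Fin d, fun g : Fin d → ℝ => v j * g j) = fun g => ∑ j, v j * g j := by
    ext g; simp
  rw [h2] at h
  rw [h, EuclideanSpace.real_norm_sq_eq, Finset.mul_sum]
  refine Finset.sum_congr rfl fun j _ => ?_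
  rw [variance_const_mul, variance_fun_id_gaussianReal, Real.coe_toNNReal _ (sq_nonneg _), mul_comm]

open Classical in
/-- The entries of `v` in `P`, with zeros elsewhere. -/
def restrictTo (P : Set (Fin d)) (v : EuclideanSpace ℝ (Fin d)) : EuclideanSpace ℝ (Fin d) :=
  WithLp.toLp 2 fun j => if j ∈ P then v j else 0

theorem norm_restrictTo_sq_add (P : Set (Fin d)) (v : EuclideanSpace ℝ (Fin d)) :
    ‖restrictTo P v‖ ^ 2 + ‖restrictTo Pᶜ v‖ ^ 2 = ‖v‖ ^ 2 := by
  simp only [EuclideanSpace.real_norm_sq_eq, ← Finset.sum_add_distrib]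
  refine Finset.sum_congr rfl fun j _ => ?_
  by_cases hj : j ∈ P <;> simp [restrictTo, hj]

open Classical in
/-- The centred example whose entries outside `P` are replaced by those of `g`. -/
def centerFill (P : Set (Fin d)) (m : EuclideanSpace ℝ (Fin d))
    (p : (Fin d → ℝ) × EuclideanSpace ℝ (Fin d)) : EuclideanSpace ℝ (Fin d) :=
  WithLp.toLp 2 fun j => if j ∈ P then p.2 j - m j else p.1 j

theorem measurable_centerFill (P : Set (Fin d)) (m : EuclideanSpace ℝ (Fin d)) :
    Measurable (centerFill P m) := by
  classical
  refine (WithLp.measurable_toLp 2 _).comp (measurable_pi_lambda _ fun j => ?_)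
  by_cases hj : j ∈ P <;> simp only [hj, if_true, if_false] <;> fun_prop

theorem inner_centerFill (P : Set (Fin d)) (m v : EuclideanSpace ℝ (Fin d))
    (p : (Fin d → ℝ) × EuclideanSpace ℝ (Fin d)) :
    ⟪centerFill P m p, v⟫ =
      (∑ j, restrictTo Pᶜ v j * p.1 j) + ⟪p.2 - m, restrictTo P v⟫ := by
  simp only [PiLp.inner_apply, ← Finset.sum_add_distrib]
  refine Finset.sum_congr rfl fun j _ => ?_
  by_cases hj : j ∈ P <;> simp [centerFill, restrictTo, hj]

/-- The inner product with `v` is a sum of two independent terms, noise against `v` off `P` and the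
example against `v` on `P`. Both the variance proxies and the variances add up by Pythagoras. -/
theorem isCenteredSubGaussian_map_centerFill {D : Measure (EuclideanSpace ℝ (Fin d))}
    (hD : D ∈ classP1 d η) (P : Set (Fin d)) :
    IsCenteredSubGaussian η
      (((Measure.pi fun _ : Fin d => gaussianReal 0 (η ^ 2).toNNReal).prod D).map
        (centerFill P (∫ x, x ∂D))) := by
  have := hD.1
  set m := ∫ x, x ∂D with hm
  set γ := Measure.pi fun _ : Fin d => gaussianReal 0 (η ^ 2).toNNReal
  have hη : ∀ _ : Fin d, η ^ 2 ≤ 1 := fun j => sq_le_one_of_mem_classP1 hD j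
  have hmeas := measurable_centerFill P m
  have hg := fun v => hasSubgaussianMGF_gaussian_sum hη (restrictTo Pᶜ v)
  have hx := fun v => hasSubgaussianMGF_inner_sub_mean hD (restrictTo P v)
  have hgm : ∀ v, Measurable fun g : Fin d → ℝ => ∑ j, restrictTo Pᶜ v j * g j :=
    fun v => by fun_prop
  have hxm : ∀ v, Measurable fun x : EuclideanSpace ℝ (Fin d) => ⟪x - m, restrictTo P v⟫ :=
    fun v => by fun_prop
  have hsub : ∀ v, HasSubgaussianMGF (fun p => ⟪centerFill P m p, v⟫) (‖v‖₊ ^ 2) (γ.prod D) := by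
    intro v
    have h1 : HasSubgaussianMGF (fun p : (Fin d → ℝ) × EuclideanSpace ℝ (Fin d) =>
        ∑ j, restrictTo Pᶜ v j * p.1 j) (‖restrictTo Pᶜ v‖₊ ^ 2) (γ.prod D) :=
      HasSubgaussianMGF.of_map (Y := Prod.fst)
        (X := fun g : Fin d → ℝ => ∑ j, restrictTo Pᶜ v j * g j) (by fun_prop) (by
          rw [(measurePreserving_fst (μ := γ) (ν := D)).map_eq]; exact hg v)
    have h2 : HasSubgaussianMGF (fun p : (Fin d → ℝ) × EuclideanSpace ℝ (Fin d) =>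
        ⟪p.2 - m, restrictTo P v⟫) (‖restrictTo P v‖₊ ^ 2) (γ.prod D) :=
      HasSubgaussianMGF.of_map (Y := Prod.snd)
        (X := fun x : EuclideanSpace ℝ (Fin d) => ⟪x - m, restrictTo P v⟫) (by fun_prop) (by
          rw [(measurePreserving_snd (μ := γ) (ν := D)).map_eq]; exact hx v)
    have h3 := h1.add_of_indepFun h2 (indepFun_prod (hgm v) (hxm v))
    simp_rw [inner_centerFill]
    refine hasSubgaussianMGF_mono h3 (le_of_eq ?_)
    rw [← NNReal.coe_inj]
    push_cast
    linarith [norm_restrictTo_sq_add P v]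
  refine ⟨fun v hv => ?_, fun v => ?_⟩
  · have h := hasSubgaussianMGF_mono (hsub v) (c' := 1) (by
      rw [← NNReal.coe_le_coe]
      push_cast
      exact pow_le_one₀ (norm_nonneg v) hv)
    have hm1 : AEMeasurable (centerFill P m) (γ.prod D) := hmeas.aemeasurable
    refine ⟨fun t => ?_, fun t => ?_⟩
    · rw [integrable_map_measure (by fun_prop) hm1]
      exact h.integrable_exp_mul t
    · rw [mgf_map hm1 (by fun_prop)]
      exact h.mgf_le t
  · rw [integral_map hmeas.aemeasurable (by fun_prop)]
    have hmean : ∫ p, ⟪centerFill P m p, v⟫ ∂(γ.prod D) = 0 := by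
      simp_rw [inner_centerFill]
      rw [integral_add ((hg v).integrable.comp_fst D) ((hx v).integrable.comp_snd γ),
        integral_fun_fst (f := fun g : Fin d → ℝ => ∑ j, restrictTo Pᶜ v j * g j),
        integral_fun_snd (f := fun x : EuclideanSpace ℝ (Fin d) => ⟪x - m, restrictTo P v⟫),
        integral_gaussian_sum, integral_inner_sub_mean hD]
      simp
    have hvar := variance_of_integral_eq_zero (hsub v).aemeasurable hmean
    have h4 := variance_add_prod (μ := γ) (ν := D) ((hg v).memLp 2) ((hx v).memLp 2)
    rw [variance_gaussian_sum, variance_inner_sub_mean hD, ← mul_add, add_comm (‖_‖ ^ 2),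
      norm_restrictTo_sq_add] at h4
    rw [← hvar, ← h4]
    simp_rw [inner_centerFill, hm]

end Directions

/-! ### From regular samples to good datasets -/

section Goodness

open Classical in
/-- The sets `Γ_j` of a family of sets of present coordinates, and the set of all examples. -/
def presentSets {N d : ℕ} (P : Fin N → Set (Fin d)) (o : Option (Fin d)) : Finset (Fin N) :=
  o.elim Finset.univ fun j => Finset.univ.filter fun i => j ∈ P i

theorem mem_presentSets_some {N d : ℕ} {P : Fin N → Set (Fin d)} {j : Fin d} {i : Fin N} :
    i ∈ presentSets P (some j) ↔ j ∈ P i := by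
  simp [presentSets]

variable {N d : ℕ} {ε : ℝ} {𝓓 : Set (Measure (EuclideanSpace ℝ (Fin d)))}
  {Ω : Type*} [MeasurableSpace Ω] {Pr : Measure Ω} {S : Type*} [MeasurableSpace S]

namespace CorruptedDataset

variable (A : CorruptedDataset N d ε 𝓓 Pr S)

/-- The centred examples before corruption, with concealed entries replaced by those of `g`. -/
def centered (s : S) (x : Fin N → EuclideanSpace ℝ (Fin d)) (g : Fin N → Fin d → ℝ) :
    Fin N → EuclideanSpace ℝ (Fin d) :=
  fun i => centerFill (A.present s i) (A.mean s) (g i, x i)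

open Classical in
/-- The examples that the adversary leaves untouched. -/
def untouched (ω : Ω) : Finset (Fin N) :=
  Finset.univ.filter fun i => A.value ω i = A.clean ω i ∧ A.mask ω i = A.present (A.seed ω) i

theorem card_untouched_ge (ω : Ω) : (1 - ε) * N ≤ ((A.untouched ω).card : ℝ) := by
  classical
  have h := A.card_corrupted_le ω
  have h1 : {i | A.value ω i ≠ A.clean ω i ∨ A.mask ω i ≠ A.present (A.seed ω) i} =
      (((A.untouched ω)ᶜ : Finset (Fin N)) : Set (Fin N)) := by
    ext i
    simp [untouched, imp_iff_not_or]
  rw [h1, Set.ncard_coe_finset] at h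
  have h2 := Finset.card_add_card_compl (A.untouched ω)
  rw [Fintype.card_fin] at h2
  have h3 : ((A.untouched ω).card : ℝ) + ((A.untouched ω)ᶜ.card : ℝ) = N := by exact_mod_cast h2
  linarith

variable {A} {ω : Ω}

theorem mem_presentIn_observed_iff {i : Fin N} (hi : i ∈ A.untouched ω) (j : Fin d) :
    i ∈ presentIn (A.observed ω) j ↔ i ∈ presentSets (A.present (A.seed ω)) (some j) := by
  have h := (Finset.mem_filter.1 hi).2.2
  rw [mem_presentSets_some, ← h, presentIn, Finset.mem_filter]
  by_cases hj : j ∈ A.mask ω i <;> simp [observed, hj]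

/-- In a concealed coordinate, adding the true mean and subtracting it again leaves exactly the
noise. -/
theorem adjust_sub_mean_eq {i : Fin N} (hi : i ∈ A.untouched ω) (g : Fin N → Fin d → ℝ) :
    adjust (A.observed ω) (fillMissing (A.observed ω) g) (A.mean (A.seed ω)) i -
      A.mean (A.seed ω) = A.centered (A.seed ω) (A.clean ω) g i := by
  obtain ⟨hv, hm⟩ := (Finset.mem_filter.1 hi).2
  ext j
  by_cases hj : j ∈ A.mask ω i
  · have hj' : j ∈ A.present (A.seed ω) i := hm ▸ hj
    simp [adjust, fillMissing, observed, centered, centerFill, hj, hj', hv]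
  · have hj' : j ∉ A.present (A.seed ω) i := hm ▸ hj
    simp [adjust, fillMissing, observed, centered, centerFill, hj, hj']

theorem isGood_of_isRegular {γ δ η : ℝ} {g : Fin N → Fin d → ℝ} (hN : 0 < N) (hε : 0 < ε)
    (hγ : 10 * ε ≤ γ) (hγ1 : γ ≤ 1) (hδ : 0 < δ) (hδ1 : δ < 1 / 2)
    {V : Finset (EuclideanSpace ℝ (Fin d))}
    (hlin : ∀ (v : EuclideanSpace ℝ (Fin d)) (a : ℝ), (∀ x ∈ V, ⟪v, x⟫ ≤ a) → ‖v‖ ≤ 2 * a)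
    (hquad : ∀ (B : EuclideanSpace ℝ (Fin d) →L[ℝ] EuclideanSpace ℝ (Fin d)) (a : ℝ),
      (∀ x y, ⟪B x, y⟫ = ⟪B y, x⟫) → (∀ v ∈ V, |⟪B v, v⟫| ≤ a) → ‖B‖ ≤ 8 * a)
    (hreg : IsRegular V (presentSets (A.present (A.seed ω))) ε η
      (10 * (d + Real.log (1 / δ))) (A.centered (A.seed ω) (A.clean ω) g))
    (hcomp : IsGammaComplete γ (A.observed ω)) :
    IsGood ε (0.9 * γ) η
      (160 * √((d + Real.log (1 / δ)) / (N * ε) + ε * Real.log (1 / ε)))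
      (A.mean (A.seed ω)) (A.observed ω) (fillMissing (A.observed ω) g) := by
  classical
  have hN' : (0 : ℝ) < N := Nat.cast_pos.2 hN
  have hε1 : ε ≤ 1 / 10 := by linarith
  have hlogδ : 0 < Real.log (1 / δ) := Real.log_pos (by rw [lt_div_iff₀ hδ]; linarith)
  have hlogε : 0 ≤ Real.log (1 / ε) := Real.log_nonneg (by rw [le_div_iff₀ hε]; linarith)
  set br := (d + Real.log (1 / δ)) / (N * ε) + ε * Real.log (1 / ε) with hbr
  have hbr0 : 0 ≤ br := by positivity
  set L := 10 * (d + Real.log (1 / δ)) with hL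
  have hL0 : 0 < L := by positivity
  set b := L / (N * ε) + ε * Real.log (1 / ε) with hb
  have hb10 : b ≤ 10 * br := by
    rw [hb, hbr, hL, mul_div_assoc, mul_add]
    have : 0 ≤ ε * Real.log (1 / ε) := by positivity
    linarith
  have hsqrt : 48 * √(ε * b) ≤ 160 * √br * √ε := by
    -- `10/3` is a rational upper bound for `√10`, chosen so that `48 · 10/3 = 160`.
    have h1 : √(ε * b) ≤ 10 / 3 * (√br * √ε) := by
      rw [← Real.sqrt_mul hbr0, Real.sqrt_le_left (by positivity), mul_pow,
        Real.sq_sqrt (by positivity)]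
      nlinarith [mul_le_mul_of_nonneg_left hb10 hε.le, mul_nonneg hbr0 hε.le]
    linarith
  set G := A.untouched ω with hG
  set y := A.centered (A.seed ω) (A.clean ω) g with hy
  have hcard := A.card_untouched_ge ω
  have hGpos : (0 : ℝ) < G.card := lt_of_lt_of_le (mul_pos (by linarith) hN') hcard
  have hGN : (G.card : ℝ) ≤ N := by
    exact_mod_cast (Finset.card_le_univ G).trans_eq (Fintype.card_fin N)
  refine ⟨G, hcard, fun j => ?_, ?_⟩
  · rw [le_div_iff₀ hGpos]
    -- Inclusion–exclusion: at most `εN` examples lie outside `G`, so `|G_j| ≥ (γ - ε) N ≥ 0.9 γ N`,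
    -- using `10ε ≤ γ`.
    have h1 : ((presentIn (A.observed ω) j).card : ℝ) + G.card ≤
        (G ∩ presentIn (A.observed ω) j).card + N := by
      have h2 := Finset.card_union_add_card_inter (presentIn (A.observed ω) j) G
      have h3 := (Finset.card_le_univ (presentIn (A.observed ω) j ∪ G)).trans_eq
        (Fintype.card_fin N)
      rw [Finset.inter_comm] at h2
      exact_mod_cast (by omega)
    have h4 := hcomp j
    have h5 : 0.9 * γ * G.card ≤ 0.9 * γ * N := by
      have : 0 < γ := by linarith
      gcongr
    nlinarith
  · rintro w ⟨hw0, hw1, hwG, hw⟩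
    have hlinear : ∀ o, ‖∑ i ∈ presentSets (A.present (A.seed ω)) o, w i • y i‖ ≤
        160 * √br * √ε := by
      intro o
      refine (hlin _ _ fun v hv => hreg.linear_le hN hε hε1 hL0 hw0 hw1 hw hv o).trans ?_
      linarith
    have hadj : ∀ i ∈ G, adjust (A.observed ω) (fillMissing (A.observed ω) g)
        (A.mean (A.seed ω)) i - A.mean (A.seed ω) = y i := fun i hi => adjust_sub_mean_eq hi g
    refine ⟨?_, ?_, fun j => ?_⟩
    · have h1 : ∑ i ∈ G, w i • (adjust (A.observed ω) (fillMissing (A.observed ω) g)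
          (A.mean (A.seed ω)) i - A.mean (A.seed ω)) = ∑ i, w i • y i := by
        rw [Finset.sum_congr rfl fun i hi => by rw [hadj i hi]]
        exact Finset.sum_subset (Finset.subset_univ _) fun i _ hi => by rw [hwG i hi, zero_smul]
      rw [h1]
      exact hlinear none
    · have h1 : ∑ i ∈ G, w i • outer (adjust (A.observed ω) (fillMissing (A.observed ω) g)
          (A.mean (A.seed ω)) i - A.mean (A.seed ω)) = ∑ i, w i • outer (y i) := by
        rw [Finset.sum_congr rfl fun i hi => by rw [hadj i hi]]
        exact Finset.sum_subset (Finset.subset_univ _) fun i _ hi => by rw [hwG i hi, zero_smul]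
      rw [h1, opNorm]
      refine (hquad _ (227 * b) (fun x z => ?_) fun v hv => ?_).trans ?_
      · rw [inner_toEuclideanCLM_sum_outer, inner_toEuclideanCLM_sum_outer, real_inner_comm]
        congr 1
        exact Finset.sum_congr rfl fun i _ => by ring
      · rw [inner_toEuclideanCLM_sum_outer]
        exact hreg.abs_quadratic_le hN hε hε1 hL0 hw0 hw1 hw hv
      -- `8 · 227 · 10 = 18160 ≤ 160²`.
      · rw [mul_pow, Real.sq_sqrt hbr0]
        linarith
    · have h1 : ∑ i ∈ G ∩ presentIn (A.observed ω) j,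
          w i • (adjust (A.observed ω) (fillMissing (A.observed ω) g)
          (A.mean (A.seed ω)) i - A.mean (A.seed ω)) =
          ∑ i ∈ presentSets (A.present (A.seed ω)) (some j), w i • y i := by
        rw [Finset.sum_congr rfl fun i hi => by rw [hadj i (Finset.mem_inter.1 hi).1]]
        refine Finset.sum_subset (fun i hi => ?_) fun i hi hi' => ?_
        · obtain ⟨hi1, hi2⟩ := Finset.mem_inter.1 hi
          exact (mem_presentIn_observed_iff hi1 j).1 hi2
        · by_cases hiG : i ∈ G
          · exact absurd (Finset.mem_inter.2 ⟨hiG, (mem_presentIn_observed_iff hiG j).2 hi⟩) hi'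
          · rw [hwG i hiG, zero_smul]
      rw [h1]
      exact hlinear (some j)

end CorruptedDataset

end Goodness

/-! ### The probability of regularity -/

section Law

variable {N d : ℕ} {ε η : ℝ} {Ω : Type*} [MeasurableSpace Ω] {Pr : Measure Ω}
  {S : Type*} [MeasurableSpace S] (A : CorruptedDataset N d ε (classP1 d η) Pr S)

/-- The law of the Gaussian variables that replace the missing entries. -/
abbrev fillLaw (N d : ℕ) (η : ℝ) : Measure (Fin N → Fin d → ℝ) :=
  Measure.pi fun _ : Fin N => Measure.pi fun _ : Fin d => gaussianReal 0 (η ^ 2).toNNReal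

namespace CorruptedDataset

theorem isProbabilityMeasure_dist (s : S) (i : Fin N) : IsProbabilityMeasure (A.dist s i) :=
  (A.dist_mem s i).1

theorem isMarkovKernel_law : IsMarkovKernel A.law := ⟨fun s => by
  have := A.isProbabilityMeasure_dist s
  rw [A.law_eq]
  infer_instance⟩

/-- Measurability of the mean is not part of the model; it is recovered by integrating one example
against the kernel `law`, which needs `N > 0`. -/
theorem measurable_mean (hN : 0 < N) : Measurable A.mean := by
  have := A.isMarkovKernel_law
  have h : ∀ s, A.mean s = ∫ x, x ⟨0, hN⟩ ∂(A.law s) := by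
    intro s
    have := A.isProbabilityMeasure_dist s
    rw [← A.dist_mean s ⟨0, hN⟩, A.law_eq,
      ← (measurePreserving_eval (A.dist s) ⟨0, hN⟩).map_eq]
    exact integral_map (φ := fun x : Fin N → EuclideanSpace ℝ (Fin d) => x ⟨0, hN⟩)
      (f := fun y => y) (measurable_pi_apply _).aemeasurable aestronglyMeasurable_id
  rw [show A.mean = fun s => ∫ x, x ⟨0, hN⟩ ∂(A.law s) from funext h]
  have hm : Measurable fun x : Fin N → EuclideanSpace ℝ (Fin d) => x ⟨0, hN⟩ := by fun_prop
  exact hm.stronglyMeasurable.integral_kernel.measurable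

theorem measurableSet_mem_present (i : Fin N) (j : Fin d) :
    MeasurableSet {s | j ∈ A.present s i} := by
  have h : Measurable fun s => j ∈ A.present s i :=
    (measurable_set_mem j).comp ((measurable_pi_apply i).comp A.measurable_present)
  exact measurableSet_setOfPred.2 h

theorem measurable_centered (hN : 0 < N) :
    Measurable fun p : (Fin N → Fin d → ℝ) × S × (Fin N → EuclideanSpace ℝ (Fin d)) =>
      A.centered p.2.1 p.2.2 p.1 := by
  classical
  have hmean := A.measurable_mean hN
  refine measurable_pi_lambda _ fun i => (WithLp.measurable_toLp 2 _).comp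
    (measurable_pi_lambda _ fun j => ?_)
  refine Measurable.ite ((A.measurableSet_mem_present i j).preimage
    (measurable_fst.comp measurable_snd)) ?_ ?_
  · fun_prop
  · fun_prop

/-- For a fixed seed each centred example is a function of its own pair of noise and sample, so
regrouping the pairs preserves the product structure. -/
theorem map_centered (s : S) :
    ((fillLaw N d η).prod (A.law s)).map (fun p => A.centered s p.2 p.1) =
      Measure.pi fun i => ((Measure.pi fun _ : Fin d => gaussianReal 0 (η ^ 2).toNNReal).prod
        (A.dist s i)).map (centerFill (A.present s i) (A.mean s)) := by
  have := A.isProbabilityMeasure_dist s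
  have hm : ∀ i, IsProbabilityMeasure (((Measure.pi fun _ : Fin d =>
      gaussianReal 0 (η ^ 2).toNNReal).prod (A.dist s i)).map
        (centerFill (A.present s i) (A.mean s))) := fun i =>
    Measure.isProbabilityMeasure_map (measurable_centerFill _ _).aemeasurable
  rw [A.law_eq, ← (measurePreserving_arrowProdEquivProdArrow (Fin d → ℝ)
    (EuclideanSpace ℝ (Fin d)) (Fin N)
    (fun _ => Measure.pi fun _ : Fin d => gaussianReal 0 (η ^ 2).toNNReal) (A.dist s)).map_eq,
    ← Measure.pi_map_pi fun i => (measurable_centerFill _ _).aemeasurable,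
    Measure.map_map _ (MeasurableEquiv.measurable _)]
  · rfl
  · exact measurable_pi_lambda _ fun i => (measurable_centerFill _ _).comp (by fun_prop)

variable [IsProbabilityMeasure Pr]

/-- The event involves only the fill, the seed and the clean sample. Their joint law disintegrates
over the seed, and the product-measure bound holds for each seed. -/
theorem measure_not_isRegular_centered_le {ξ : Ω → Fin N → Fin d → ℝ} (hξ : IsGaussianFill A η ξ)
    {δ : ℝ} (hN : 0 < N) (hδ : 0 < δ) (hδ1 : δ < 1 / 2) (hε : 0 < ε) (hε1 : ε ≤ 1 / 10)
    {V : Finset (EuclideanSpace ℝ (Fin d))} (hVcard : V.card ≤ 3 * 25 ^ d)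
    (hV : ∀ v ∈ V, ‖v‖ ≤ 1) :
    Pr {ω | ¬ IsRegular V (presentSets (A.present (A.seed ω))) ε η
      (10 * (d + Real.log (1 / δ))) (A.centered (A.seed ω) (A.clean ω) (ξ ω))} ≤
      ENNReal.ofReal δ := by
  have := A.isMarkovKernel_law
  set L := 10 * (d + Real.log (1 / δ))
  set B : Set ((Fin N → Fin d → ℝ) × S × (Fin N → EuclideanSpace ℝ (Fin d))) :=
    {p | ¬ IsRegular V (presentSets (A.present p.2.1)) ε η L (A.centered p.2.1 p.2.2 p.1)} with hB
  have hBmeas : MeasurableSet B := by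
    refine (measurableSet_isRegular V ε η L (fun o i => ?_) (A.measurable_centered hN)).compl
    cases o with
    | none => simp [presentSets]
    | some j =>
      simp only [mem_presentSets_some]
      exact (A.measurableSet_mem_present i j).preimage (measurable_fst.comp measurable_snd)
  have hsc : Measurable fun ω => (A.seed ω, A.clean ω) :=
    A.measurable_seed.prodMk A.measurable_clean
  have hind : IndepFun ξ (fun ω => (A.seed ω, A.clean ω)) Pr :=
    hξ.indep.comp (φ := id)
      (ψ := fun q : S × (Fin N → EuclideanSpace ℝ (Fin d)) ×
        (Fin N → EuclideanSpace ℝ (Fin d)) × (Fin N → Set (Fin d)) => (q.1, q.2.1))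
      measurable_id (by fun_prop)
  have hmap : Pr.map (fun ω => (ξ ω, A.seed ω, A.clean ω)) =
      (fillLaw N d η).prod ((Pr.map A.seed) ⊗ₘ A.law) := by
    rw [hind.map_prod_eq_prod_map_map hξ.measurable.aemeasurable hsc.aemeasurable, hξ.map_eq,
      A.map_seed_clean]
  have hprob : IsProbabilityMeasure (Pr.map A.seed) :=
    Measure.isProbabilityMeasure_map A.measurable_seed.aemeasurable
  calc _ = Pr.map (fun ω => (ξ ω, A.seed ω, A.clean ω)) B :=
        (Measure.map_apply (hξ.measurable.prodMk hsc) hBmeas).symm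
    _ = ∫⁻ s, ((fillLaw N d η).prod (A.law s)) {p | (p.1, s, p.2) ∈ B} ∂(Pr.map A.seed) := by
        rw [hmap, Measure.prod_apply_symm hBmeas,
          Measure.lintegral_compProd (measurable_measure_prodMk_right hBmeas)]
        refine lintegral_congr fun s => ?_
        rw [Measure.prod_apply_symm]
        · rfl
        · exact hBmeas.preimage (f := fun p : (Fin N → Fin d → ℝ) ×
            (Fin N → EuclideanSpace ℝ (Fin d)) => (p.1, s, p.2)) (by fun_prop)
    _ ≤ ∫⁻ _, ENNReal.ofReal δ ∂(Pr.map A.seed) := by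
        refine lintegral_mono fun s => ?_
        have hd := A.isProbabilityMeasure_dist s
        have hm : ∀ i, IsProbabilityMeasure (((Measure.pi fun _ : Fin d =>
            gaussianReal 0 (η ^ 2).toNNReal).prod (A.dist s i)).map
              (centerFill (A.present s i) (A.mean s))) := fun i =>
          Measure.isProbabilityMeasure_map (measurable_centerFill _ _).aemeasurable
        have hν : ∀ i, IsCenteredSubGaussian η (((Measure.pi fun _ : Fin d =>
            gaussianReal 0 (η ^ 2).toNNReal).prod (A.dist s i)).map
              (centerFill (A.present s i) (A.mean s))) := fun i => by
          rw [← A.dist_mean s i]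
          exact isCenteredSubGaussian_map_centerFill (A.dist_mem s i) _
        have hle := measure_not_isRegular_le_ofReal hN hν hδ hδ1 hε hε1 hVcard hV
          (presentSets (A.present s))
        rw [← A.map_centered s, Measure.map_apply] at hle
        · exact hle
        · exact (A.measurable_centered hN).comp (f := fun p : (Fin N → Fin d → ℝ) ×
            (Fin N → EuclideanSpace ℝ (Fin d)) => (p.1, s, p.2)) (by fun_prop)
        · exact (measurableSet_isRegular V ε η L (T := fun _ => presentSets (A.present s))
            (fun _ _ => .const _) measurable_id).compl
    _ = ENNReal.ofReal δ := by simp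

end CorruptedDataset

end Law

end RobustMean

end

theorem mainTheorem5 :
    ∃ C : ℝ, 0 < C ∧
      ∀ (N d : ℕ) (ε γ δ η : ℝ), 0 < N → 0 < ε → 10 * ε ≤ γ → γ ≤ 1 → 0 < δ → δ < 1 / 2 → 0 ≤ η →
      ∀ {Ω S : Type*} [MeasurableSpace Ω] [MeasurableSpace S]
        (Pr : Measure Ω) [IsProbabilityMeasure Pr]
        (A : CorruptedDataset N d ε (classP1 d η) Pr S)
        (ξ : Ω → Fin N → Fin d → ℝ), IsGaussianFill A η ξ →
      ∀ β : ℝ, β = C * √((d + Real.log (1 / δ)) / (N * ε) + ε * Real.log (1 / ε)) →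
        Pr {ω | IsGammaComplete γ (A.observed ω) ∧
          ¬ IsGood ε (0.9 * γ) η β (A.mean (A.seed ω)) (A.observed ω)
              (fillMissing (A.observed ω) (ξ ω))} ≤ ENNReal.ofReal δ := by
  refine ⟨160, by norm_num, ?_⟩
  intro N d ε γ δ η hN hε hγ hγ1 hδ hδ1 _ Ω S _ _ Pr _ A ξ hξ β hβ
  obtain ⟨V, hVcard, hV, hlin, hquad⟩ := exists_test_set (EuclideanSpace ℝ (Fin d))
  rw [finrank_euclideanSpace_fin] at hVcard
  -- Only an inclusion into the irregular event is needed, so the event of the theorem need not be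
  -- shown measurable.
  refine le_trans (measure_mono ?_)
    (A.measure_not_isRegular_centered_le hξ hN hδ hδ1 hε (by linarith) hVcard hV)
  rintro ω ⟨hcomp, hbad⟩ hreg
  subst hβ
  exact hbad (CorruptedDataset.isGood_of_isRegular hN hε hγ hγ1 hδ hδ1 hlin hquad hreg hcomp)
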